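/- Let $\overline{\mathbb{Q}}$ be an algebraic closure of $\mathbb{Q}$ and let $\mathrm{h}\colon\mathbb{P}^2(\overline{\mathbb{Q}})\to\mathbb{R}$ be the canonical (absolute logarithmic Weil) height, $$\mathrm{h}([\xi_0:\xi_1:\xi_2])=\sum_{w}\frac{[K_w:\mathbb{Q}_v]}{[K:\mathbb{Q}]}\log\max(|\xi_0|_w,|\xi_1|_w,|\xi_2|_w),$$ where $K$ is any number field containing $\xi_0,\xi_1,\xi_2$, $w$ runs over the places of $K$, $v$ is the place of $\mathbb{Q}$ below $w$, and $|\cdot|_w$ extends the standard absolute value $|\cdot|_v$ of $\mathbb{Q}$. Let $C\subset\mathbb{P}^2(\overline{\mathbb{Q}})$ be the line $x_0+x_1+x_2=0$ and, for $\omega=(\omega_1,\omega_2)\in(\overline{\mathbb{Q}}^\times)^2$, let $\omega C=\{[x_0:\omega_1x_1:\omega_2x_2]\mid[x_0:x_1:x_2]\in C\}$. If $\omega\neq(1,1)$, then $C\cap\omega C$ consists of a single point, and $\mathrm{h}(C\cap\omega C)$ denotes the height of this point. For $d\ge1$ let $\mu_d\subset\overline{\mathbb{Q}}^\times$ be the group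 of $d$-th roots of unity, and put $$\eta=\frac{2\,\zeta(3)}{3\,\zeta(2)},$$ where $\zeta$ is the Riemann zeta function. Then for every $\varepsilon>0$ $$\lim_{d\to+\infty}\frac{1}{d^2-1}\,\#\{\omega\in\mu_d^2\setminus\{(1,1)\}\mid|\mathrm{h}(C\cap\omega C)-\eta|<\varepsilon\}=1,$$ and moreover $$\lim_{d\to+\infty}\frac{1}{d^2-1}\sum_{\omega\in\mu_d^2\setminus\{(1,1)\}}\mathrm{h}(C\cap\omega C)=\eta.$$ -/

import Mathlib

open Filter Topology

/-- A fixed algebraic closure of the field of rational numbers. -/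
abbrev QBar : Type := AlgebraicClosure ℚ

instance instIsAlgebraicQBar : Algebra.IsAlgebraic ℚ QBar := AlgebraicClosure.isAlgebraic ℚ

/-- The projective space `ℙⁿ(QBar)`, with homogeneous coordinates indexed by `0, …, n`. -/
abbrev ProjSpace (n : ℕ) : Type := Projectivization QBar (Fin (n + 1) → QBar)

/-- The `n`-dimensional split torus `(QBarˣ)ⁿ`, a group under coordinatewise multiplication. -/
abbrev Torus (n : ℕ) : Type := Fin n → QBarˣ

/-- The number field generated over `ℚ` by the coordinates of a vector. -/
noncomputable abbrev coordField {n : ℕ} (x : Fin (n + 1) → QBar) : IntermediateField ℚ QBar :=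
  IntermediateField.adjoin ℚ (Set.range x)

theorem numberField_coordField {n : ℕ} (x : Fin (n + 1) → QBar) : NumberField (coordField x) where
  to_charZero := inferInstance
  to_finiteDimensional := by
    have : Finite (Set.range x) := Set.finite_range x
    exact IntermediateField.finiteDimensional_adjoin
      fun y _ => (Algebra.IsAlgebraic.isAlgebraic (R := ℚ) y).isIntegral

/-- The absolute logarithmic height of a vector `x` of algebraic numbers. With
`K = ℚ(x₀, …, xₙ)` it is `[K : ℚ]⁻¹ * ∑_w log max_i ‖x_i‖_w` over the places `w` of `K`, where
`‖·‖_w = |·|_w ^ [K_w : ℚ_v]` is the normalized absolute value: `Height.logHeight` is this sum of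
local terms, not yet divided by the degree of the number field. -/
noncomputable def vecHeight {n : ℕ} (x : Fin (n + 1) → QBar) : ℝ :=
  haveI : NumberField (coordField x) := numberField_coordField x
  Height.logHeight (K := coordField x)
      (fun i => ⟨x i, IntermediateField.subset_adjoin ℚ _ (Set.mem_range_self i)⟩) /
    (Module.finrank ℚ (coordField x) : ℝ)

/-- The canonical height of a point of projective space: the height of a vector of homogeneous
coordinates (by the product formula the choice of this vector does not matter). -/
noncomputable def projHeight {n : ℕ} (ξ : ProjSpace n) : ℝ := vecHeight ξ.rep

/-- The height of a finite set of points, as the sum of the heights of its points. It is applied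
below to sets that consist of a single point, where it is the height of that point. -/
noncomputable def setHeight {n : ℕ} (S : Set (ProjSpace n)) : ℝ := ∑ᶠ ξ ∈ S, projHeight ξ

/-- The linear map `(x₀, x₁, …, xₙ) ↦ (x₀, γ₁ x₁, …, γₙ xₙ)`. -/
noncomputable def scaleMap {n : ℕ} (γ : Torus n) : (Fin (n + 1) → QBar) →ₗ[QBar] (Fin (n + 1) → QBar) :=
  LinearMap.pi fun i =>
    ((Fin.cons 1 γ : Fin (n + 1) → QBarˣ) i : QBar) • LinearMap.proj (R := QBar) i

theorem scaleMap_apply {n : ℕ} (γ : Torus n) (x : Fin (n + 1) → QBar) (i : Fin (n + 1)) :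
    scaleMap γ x i = ((Fin.cons 1 γ : Fin (n + 1) → QBarˣ) i : QBar) * x i := rfl

theorem scaleMap_injective {n : ℕ} (γ : Torus n) : Function.Injective (scaleMap γ) := by
  intro x y h
  funext i
  have hi := congrFun h i
  rw [scaleMap_apply, scaleMap_apply] at hi
  exact (Units.mul_right_inj _).1 hi

/-- The action of the torus on projective space:
`γ · [x₀ : x₁ : … : xₙ] = [x₀ : γ₁ x₁ : … : γₙ xₙ]`. -/
noncomputable def torusTranslate {n : ℕ} (γ : Torus n) : ProjSpace n → ProjSpace n :=
  Projectivization.map (scaleMap γ) (scaleMap_injective γ)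

/-- The projective line `C = Z(x₀ + x₁ + x₂)` in the projective plane. -/
def lineC : Set (ProjSpace 2) := {ξ | ξ.rep 0 + ξ.rep 1 + ξ.rep 2 = 0}

/-- The set `μ_d² ∖ {(1, 1)}` of nontrivial `d`-torsion points of the `2`-dimensional torus. -/
def nontrivialTorsion (d : ℕ) : Set (Torus 2) :=
  {ω | ∀ i, ω i ∈ rootsOfUnity d QBar} \ {1}

/-- The height `h(C ∩ ω C)` of the intersection of `C` with its torusTranslate by `ω`. -/
noncomputable def interHeight (ω : Torus 2) : ℝ := setHeight (lineC ∩ torusTranslate ω '' lineC)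

/-- The real number `η = 2 ζ(3) / (3 ζ(2))`. -/
noncomputable def etaConst : ℝ := 2 * (riemannZeta 3).re / (3 * (riemannZeta 2).re)

theorem mk_mem_lineC (x : Fin 3 → QBar) (hx : x ≠ 0) :
    Projectivization.mk QBar x hx ∈ lineC ↔ x 0 + x 1 + x 2 = 0 := by
  obtain ⟨a, ha⟩ := Projectivization.exists_smul_eq_mk_rep QBar x hx
  simp only [lineC, Set.mem_ofPred_eq, ← ha, Pi.smul_apply, ← smul_add]
  exact smul_eq_zero_iff_eq a

theorem mk_mem_torusTranslate_lineC (ω : Torus 2) (x : Fin 3 → QBar) (hx : x ≠ 0) :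
    Projectivization.mk QBar x hx ∈ torusTranslate ω '' lineC ↔
      x 0 + (ω 0 : QBar)⁻¹ * x 1 + (ω 1 : QBar)⁻¹ * x 2 = 0 := by
  have h0 : (ω 0 : QBar) ≠ 0 := (ω 0).ne_zero
  have h1 : (ω 1 : QBar) ≠ 0 := (ω 1).ne_zero
  have e0 : ∀ y : Fin 3 → QBar, scaleMap ω y 0 = y 0 := fun y => by simp [scaleMap_apply]
  have e1 : ∀ y : Fin 3 → QBar, scaleMap ω y 1 = (ω 0 : QBar) * y 1 := fun y => rfl
  have e2 : ∀ y : Fin 3 → QBar, scaleMap ω y 2 = (ω 1 : QBar) * y 2 := fun y => rfl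
  constructor
  · rintro ⟨ξ, hξ, h⟩
    induction ξ using Projectivization.ind with
    | h y hy =>
      rw [mk_mem_lineC] at hξ
      rw [torusTranslate, Projectivization.map_mk, Projectivization.mk_eq_mk_iff'] at h
      obtain ⟨c, hc⟩ := h
      have hc0 : c ≠ 0 := by
        rintro rfl
        rw [zero_smul] at hc
        exact hy (scaleMap_injective ω (by rw [← hc, map_zero]))
      have k0 := congrFun hc 0
      have k1 := congrFun hc 1
      have k2 := congrFun hc 2
      rw [e0, Pi.smul_apply, smul_eq_mul] at k0
      rw [e1, Pi.smul_apply, smul_eq_mul] at k1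
      rw [e2, Pi.smul_apply, smul_eq_mul] at k2
      apply (mul_eq_zero.1 (_ : c * _ = 0)).resolve_left hc0
      calc c * (x 0 + (ω 0 : QBar)⁻¹ * x 1 + (ω 1 : QBar)⁻¹ * x 2)
          = c * x 0 + (ω 0 : QBar)⁻¹ * (c * x 1) + (ω 1 : QBar)⁻¹ * (c * x 2) := by ring
        _ = y 0 + y 1 + y 2 := by
            rw [k0, k1, k2, inv_mul_cancel_left₀ h0, inv_mul_cancel_left₀ h1]
        _ = 0 := hξ
  · intro h
    have hs : scaleMap ω ![x 0, (ω 0 : QBar)⁻¹ * x 1, (ω 1 : QBar)⁻¹ * x 2] = x := by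
      funext i
      fin_cases i
      · exact e0 _
      · exact (e1 _).trans (mul_inv_cancel_left₀ h0 _)
      · exact (e2 _).trans (mul_inv_cancel_left₀ h1 _)
    have hy : ![x 0, (ω 0 : QBar)⁻¹ * x 1, (ω 1 : QBar)⁻¹ * x 2] ≠ 0 := by
      intro h'
      rw [h', map_zero] at hs
      exact hx hs.symm
    refine ⟨Projectivization.mk QBar _ hy, (mk_mem_lineC _ hy).2 h, ?_⟩
    simp only [torusTranslate, Projectivization.map_mk, hs]

/-- For nontrivial `ω` the set `C ∩ ω C` consists of exactly one point, so that `interHeight ω` is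
the height of that point. -/
theorem inter_eq_singleton (ω : Torus 2) (hω : ω ≠ 1) :
    ∃ P : ProjSpace 2, lineC ∩ torusTranslate ω '' lineC = {P} ∧ interHeight ω = projHeight P := by
  suffices h : ∃ P : ProjSpace 2, lineC ∩ torusTranslate ω '' lineC = {P} by
    obtain ⟨P, hP⟩ := h
    exact ⟨P, hP, by rw [interHeight, hP, setHeight, finsum_mem_singleton]⟩
  set a : QBar := (ω 0 : QBar)⁻¹ with ha
  set b : QBar := (ω 1 : QBar)⁻¹ with hb
  have hab : ¬ (a = 1 ∧ b = 1) := by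
    rintro ⟨h0, h1⟩
    apply hω
    funext i
    fin_cases i
    · exact Units.ext (inv_eq_one.1 h0)
    · exact Units.ext (inv_eq_one.1 h1)
  have hp : ![b - a, 1 - b, a - 1] ≠ 0 := by
    intro h
    have h1 : 1 - b = 0 := congrFun h 1
    have h2 : a - 1 = 0 := congrFun h 2
    exact hab ⟨sub_eq_zero.1 h2, (sub_eq_zero.1 h1).symm⟩
  refine ⟨Projectivization.mk QBar _ hp, Set.ext fun ξ => ?_⟩
  induction ξ using Projectivization.ind with
  | h x hx =>
    rw [Set.mem_inter_iff, mk_mem_lineC, mk_mem_torusTranslate_lineC, Set.mem_singleton_iff,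
      Projectivization.mk_eq_mk_iff', ← ha, ← hb]
    constructor
    · rintro ⟨h, h'⟩
      by_cases hb1 : 1 - b = 0
      · have ha1 : a - 1 ≠ 0 := fun k => hab ⟨sub_eq_zero.1 k, (sub_eq_zero.1 hb1).symm⟩
        refine ⟨x 2 / (a - 1), ?_⟩
        funext i
        fin_cases i
        · change x 2 / (a - 1) * (b - a) = x 0
          rw [div_mul_eq_mul_div, div_eq_iff ha1]
          linear_combination -a * h + h'
        · change x 2 / (a - 1) * (1 - b) = x 1
          rw [div_mul_eq_mul_div, div_eq_iff ha1]
          linear_combination h - h'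
        · exact div_mul_cancel₀ _ ha1
      · refine ⟨x 1 / (1 - b), ?_⟩
        funext i
        fin_cases i
        · change x 1 / (1 - b) * (b - a) = x 0
          rw [div_mul_eq_mul_div, div_eq_iff hb1]
          linear_combination b * h - h'
        · exact div_mul_cancel₀ _ hb1
        · change x 1 / (1 - b) * (a - 1) = x 2
          rw [div_mul_eq_mul_div, div_eq_iff hb1]
          linear_combination h' - h
    · rintro ⟨c, rfl⟩
      constructor
      · change c * (b - a) + c * (1 - b) + c * (a - 1) = 0
        ring
      · change c * (b - a) + a * (c * (1 - b)) + b * (c * (a - 1)) = 0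
        ring

/-!
For a nontrivial torsion point `ω`, put `a = ω₁⁻¹` and `b = ω₂⁻¹`. The point `C ∩ ω C` is
`[b - a : 1 - b : a - 1]`, whose coordinates are the sides of the triangle with vertices `1, a, b`.
Fix a primitive `d`-th root of unity `ζ`, and write `a`, `b` as powers of `ζ` with exponent vector
`v ∈ (ℤ/d)²`. The Galois group of `ℚ(ζ)` is `(ℤ/d)ˣ`, so the archimedean part of the height is the
mean over the orbit of `v` of `log (longestSide (v / d))`, where `longestSide` is the longest side
of the triangle inscribed in the unit circle.

* The finite places contribute `-1/φ(d)` times the logarithm of the norm of the ideal generated by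
  the coordinates. That ideal divides each nonzero coordinate, so the contribution is at most
  the orbit mean of `log |ζ ^ vᵢ - 1|` for any `i` with `vᵢ ≠ 0` (`interHeight_bounds`). As
  `∏ (1 - ζ ^ k) = d`, the total over all `v ≠ 0` is at most `2 d log d`, which is negligible
  against `d²`.
* For continuous `g` on the torus `(ℝ/ℤ)²`, the orbit means of `g` converge to `∫ g` in mean over
  all `d`-torsion points (`orbitEquidistributed`). For a nontrivial character the second moment of
  the orbit mean is `O(1 / φ(d))`; trigonometric polynomials are dense.
* `log longestSide` is not continuous at `0`. Truncating it at height `log δ` changes it by at most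
  the gaps `(log δ - log chord)⁺` of two chords, and the average of a gap over `(ℤ/d)` is
  asymptotically at most its integral, again by `∏ (1 - ζ ^ k) = d` together with `∫ log chord = 0`.
  That integral tends to `0` with `δ`.
* The integral of `log longestSide` over the torus equals `η` (`integral_log_longestSide`). For
  fixed `x` the longest side of the triangle `1, e^{2πix}, e^{2πiy}` is piecewise one of the chords,
  so the integral reduces to values at `1/2`, `1/3` and `2/3` of the second primitive of `log chord`.
  Its Fourier series is `-∑ (1 - cos 2πnx) / (4π²n³)`, which at these points is a rational multiple
  of `ζ(3) / π²`.

Together these give convergence of the heights to `η` in the mean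
(`tendsto_mean_abs_interHeight_sub`), which is stronger than the convergence of the averages; the
convergence in density follows by Markov's inequality.
-/

/-! ### Heights over number fields -/

section Embeddings
variable {K : Type*} [Field K] [NumberField K]

/-- The multiplicity of an infinite place is the number of embeddings that induce it. -/
theorem prod_infinitePlace_pow_mult {M : Type*} [CommMonoid M]
    (F : NumberField.InfinitePlace K → M) :
    ∏ w, F w ^ w.mult = ∏ τ : K →+* ℂ, F (NumberField.InfinitePlace.mk τ) := by
  classical
  rw [← Finset.prod_fiberwise Finset.univ NumberField.InfinitePlace.mk]
  refine Finset.prod_congr rfl fun w _ => ?_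
  rw [Finset.prod_congr rfl (g := fun _ => F w)
    (fun τ hτ => by rw [(Finset.mem_filter.1 hτ).2]), Finset.prod_const,
    NumberField.InfinitePlace.card_filter_mk_eq]

theorem iSup_norm_pos {F ι : Type*} [Field F] [Finite ι] {x : ι → F} (hx : x ≠ 0) (τ : F →+* ℂ) :
    0 < ⨆ i, ‖τ (x i)‖ := by
  obtain ⟨i, hi⟩ := Function.ne_iff.1 hx
  refine lt_of_lt_of_le (norm_pos_iff.2 ((map_ne_zero τ).2 hi)) ?_
  exact le_ciSup (f := fun i => ‖τ (x i)‖) (Set.finite_range _).bddAbove i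

/-- For integral coordinates the product of the local factors at the finite places is the inverse
of the norm of the ideal they generate. -/
theorem logHeight_integral {ι : Type*} [Finite ι] {x : ι → NumberField.RingOfIntegers K}
    (hx : x ≠ 0) :
    Height.logHeight (fun i => (x i : K)) =
      ∑ τ : K →+* ℂ, Real.log (⨆ i, ‖τ (x i)‖) -
        Real.log (Ideal.absNorm (Ideal.span (Set.range x))) := by
  have hx' : (fun i => (x i : K)) ≠ 0 := by
    obtain ⟨i, hi⟩ := Function.ne_iff.1 hx
    exact Function.ne_iff.2 ⟨i, by simpa using hi⟩
  have h := NumberField.absNorm_mul_finprod_finitePlace_eq_one hx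
  have hN : (Ideal.absNorm (Ideal.span (Set.range x)) : ℝ) ≠ 0 := left_ne_zero_of_mul_eq_one h
  rw [Height.logHeight_eq_log_mulHeight, NumberField.mulHeight_eq hx',
    prod_infinitePlace_pow_mult (fun w => ⨆ i, w ((x i : K)))]
  have hfin : (∏ᶠ v : NumberField.FinitePlace K, ⨆ i, v (x i : K)) =
      (Ideal.absNorm (Ideal.span (Set.range x)) : ℝ)⁻¹ := eq_inv_of_mul_eq_one_right h
  rw [hfin, Real.log_mul _ (inv_ne_zero hN), Real.log_inv, Real.log_prod, sub_eq_add_neg]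
  · rfl
  · exact fun τ _ => (iSup_norm_pos hx' τ).ne'
  · exact Finset.prod_ne_zero_iff.2 fun τ _ => (iSup_norm_pos hx' τ).ne'

variable {L : Type*} [Field L] [NumberField L] [Algebra K L]

/-- Every complex embedding of `K` has `[L : K]` extensions to `L`. -/
theorem sum_embeddings_comp {M : Type*} [AddCommMonoid M] (φ : (K →+* ℂ) → M) :
    ∑ τ : L →+* ℂ, φ (τ.comp (algebraMap K L)) =
      Module.finrank K L • ∑ σ : K →+* ℂ, φ σ := by
  classical
  rw [← Finset.sum_fiberwise Finset.univ (fun τ : L →+* ℂ => τ.comp (algebraMap K L)),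
    Finset.smul_sum]
  refine Finset.sum_congr rfl fun σ _ => ?_
  rw [Finset.sum_congr rfl (g := fun _ => φ σ)
    (fun τ hτ => by rw [(Finset.mem_filter.1 hτ).2]), Finset.sum_const]
  congr 1
  let _ : Algebra K ℂ := σ.toAlgebra
  rw [← AlgHom.card K L ℂ, ← Fintype.card_subtype]
  refine Fintype.card_congr
    { toFun := fun τ => { τ.1 with commutes' := fun r => DFunLike.congr_fun τ.2 r }
      invFun := fun τ => ⟨τ.toRingHom, RingHom.ext fun r => τ.commutes r⟩
      left_inv := fun _ => rfl
      right_inv := fun _ => rfl }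

/-- After clearing denominators, this compares embeddings and ideal norms of `K` and `L`. -/
theorem logHeight_algebraMap {ι : Type*} [Finite ι] (x : ι → K) :
    Height.logHeight (fun i => algebraMap K L (x i)) =
      Module.finrank K L * Height.logHeight x := by
  rcases eq_or_ne x 0 with rfl | hx
  · have : (fun i : ι => algebraMap K L ((0 : ι → K) i)) = 0 := by ext; simp
    rw [this]; simp
  -- Scaling by a common denominator does not change the heights.
  obtain ⟨m, hm⟩ := IsLocalization.exist_integer_multiples_of_finite
    (nonZeroDivisors (NumberField.RingOfIntegers K)) x
  choose y hy using hm
  obtain ⟨m, hmem⟩ := m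
  have hm0 : (m : K) ≠ 0 := by
    simpa using nonZeroDivisors.ne_zero hmem
  have hyx : (fun i => (y i : K)) = (m : K) • x := by
    ext i
    have := hy i
    rw [Algebra.smul_def] at this
    exact this
  have hy0 : y ≠ 0 := by
    rintro rfl
    apply hx
    have h0 : (m : K) • x = 0 := by rw [← hyx]; ext; simp
    exact (smul_eq_zero.1 h0).resolve_left hm0
  rw [← Height.logHeight_smul_eq_logHeight x hm0, ← hyx]
  set z : ι → NumberField.RingOfIntegers L :=
    fun i => algebraMap (NumberField.RingOfIntegers K) (NumberField.RingOfIntegers L) (y i) with hz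
  have hzy : ∀ i, (z i : L) = algebraMap K L (y i) := fun i => rfl
  have hz0 : z ≠ 0 := by
    obtain ⟨i, hi⟩ := Function.ne_iff.1 hy0
    refine Function.ne_iff.2 ⟨i, fun h => hi ?_⟩
    have h' : algebraMap K L (y i) = 0 := by rw [← hzy, h]; simp
    simpa using h'
  have hzx : (fun i => (z i : L)) = algebraMap K L m • fun i => algebraMap K L (x i) := by
    ext i
    rw [hzy, Pi.smul_apply, smul_eq_mul, ← map_mul]
    exact congrArg _ (congrFun hyx i)
  rw [← Height.logHeight_smul_eq_logHeight (fun i => algebraMap K L (x i))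
    ((map_ne_zero (algebraMap K L)).2 hm0), ← hzx, logHeight_integral hz0, logHeight_integral hy0]
  have hI : Ideal.span (Set.range z) = (Ideal.span (Set.range y)).map
      (algebraMap (NumberField.RingOfIntegers K) (NumberField.RingOfIntegers L)) := by
    rw [Ideal.map_span, ← Set.range_comp]; rfl
  have hr : Module.finrank (NumberField.RingOfIntegers K) (NumberField.RingOfIntegers L) =
      Module.finrank K L := by
    exact (IsFractionRing.finrank_eq _ K _ L).symm
  rw [hI, Ideal.absNorm_algebraMap, hr, Nat.cast_pow, Real.log_pow, mul_sub,
    ← nsmul_eq_mul _ (∑ σ : K →+* ℂ, _),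
    ← sum_embeddings_comp (L := L) (fun σ => Real.log (⨆ i, ‖σ (y i : K)‖))]
  rfl

theorem logHeight_algebraMap_div_finrank {ι : Type*} [Finite ι] (x : ι → K) :
    Height.logHeight (fun i => algebraMap K L (x i)) / Module.finrank ℚ L =
      Height.logHeight x / Module.finrank ℚ K := by
  have h2 : (Module.finrank K L : ℝ) ≠ 0 := by
    have : FiniteDimensional K L := Module.Finite.of_restrictScalars_finite ℚ _ _
    exact Nat.cast_ne_zero.2 Module.finrank_pos.ne'
  have h1 : (Module.finrank ℚ K : ℝ) ≠ 0 := Nat.cast_ne_zero.2 Module.finrank_pos.ne'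
  rw [logHeight_algebraMap, ← Module.finrank_mul_finrank ℚ K L, Nat.cast_mul]
  field_simp

end Embeddings

/-- The height can be computed in any number field that contains the coordinates. -/
theorem vecHeight_eq {n : ℕ} (x : Fin (n + 1) → QBar) (L : IntermediateField ℚ QBar)
    [NumberField L] (y : Fin (n + 1) → L) (hy : ∀ i, (y i : QBar) = x i) :
    vecHeight x = Height.logHeight y / Module.finrank ℚ L := by
  have : NumberField (coordField x) := numberField_coordField x
  have hle : coordField x ≤ L := by
    rw [IntermediateField.adjoin_le_iff]
    rintro _ ⟨i, rfl⟩
    rw [← hy]; exact (y i).2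
  let _ : Algebra (coordField x) L := (IntermediateField.inclusion hle).toRingHom.toAlgebra
  have key := logHeight_algebraMap_div_finrank (L := L) (fun i => (⟨x i,
    IntermediateField.subset_adjoin ℚ _ (Set.mem_range_self i)⟩ : coordField x))
  have hxy : (fun i => algebraMap (coordField x) L ⟨x i,
      IntermediateField.subset_adjoin ℚ _ (Set.mem_range_self i)⟩) = y := by
    ext i
    exact (hy i).symm
  rw [← hxy, key, vecHeight]

/-- The height of a vector depends only on the point of projective space it represents. -/
theorem vecHeight_smul {n : ℕ} (x : Fin (n + 1) → QBar) {c : QBar} (hc : c ≠ 0) :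
    vecHeight (c • x) = vecHeight x := by
  set L : IntermediateField ℚ QBar := IntermediateField.adjoin ℚ (insert c (Set.range x)) with hL
  have hfin : FiniteDimensional ℚ L := by
    have : Finite (insert c (Set.range x) : Set QBar) := ((Set.finite_range x).insert c)
    exact IntermediateField.finiteDimensional_adjoin
      fun y _ => (Algebra.IsAlgebraic.isAlgebraic (R := ℚ) y).isIntegral
  have : NumberField L := { to_charZero := inferInstance, to_finiteDimensional := hfin }
  have hcL : c ∈ L := IntermediateField.subset_adjoin ℚ _ (Set.mem_insert _ _)
  have hxL : ∀ i, x i ∈ L := fun i =>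
    IntermediateField.subset_adjoin ℚ _ (Set.mem_insert_of_mem _ ⟨i, rfl⟩)
  rw [vecHeight_eq x L (fun i => ⟨x i, hxL i⟩) (fun _ => rfl),
    vecHeight_eq (c • x) L ((⟨c, hcL⟩ : L) • fun i => ⟨x i, hxL i⟩) (fun _ => rfl),
    Height.logHeight_smul_eq_logHeight]
  intro h
  exact hc (congrArg Subtype.val h)

theorem projHeight_mk {n : ℕ} (x : Fin (n + 1) → QBar) (hx : x ≠ 0) :
    projHeight (Projectivization.mk QBar x hx) = vecHeight x := by
  obtain ⟨a, ha⟩ := Projectivization.exists_smul_eq_mk_rep QBar x hx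
  rw [projHeight, ← ha]
  exact vecHeight_smul x a.ne_zero

theorem interHeight_eq (ω : Torus 2) (hω : ω ≠ 1) :
    interHeight ω = vecHeight ![(ω 1 : QBar)⁻¹ - (ω 0 : QBar)⁻¹, 1 - (ω 1 : QBar)⁻¹,
      (ω 0 : QBar)⁻¹ - 1] := by
  obtain ⟨P, hP, hh⟩ := inter_eq_singleton ω hω
  set a : QBar := (ω 0 : QBar)⁻¹ with ha
  set b : QBar := (ω 1 : QBar)⁻¹ with hb
  have hp : ![b - a, 1 - b, a - 1] ≠ 0 := by
    intro h
    have h1 : 1 - b = 0 := congrFun h 1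
    have h2 : a - 1 = 0 := congrFun h 2
    apply hω
    funext i
    fin_cases i
    · exact Units.ext (inv_eq_one.1 (sub_eq_zero.1 h2))
    · exact Units.ext (inv_eq_one.1 (sub_eq_zero.1 h1).symm)
  have hm : Projectivization.mk QBar _ hp ∈ lineC ∩ torusTranslate ω '' lineC := by
    rw [Set.mem_inter_iff, mk_mem_lineC, mk_mem_torusTranslate_lineC, ← ha, ← hb]
    constructor
    · change (b - a) + (1 - b) + (a - 1) = 0
      ring
    · change (b - a) + a * (1 - b) + b * (a - 1) = 0
      ring
  rw [hP, Set.mem_singleton_iff] at hm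
  rw [hh, ← hm, projHeight_mk]

/-! ### Heights of the intersection points and Galois orbits -/

/-- The distance in `ℂ` from `1` to the point `e^{2πit}` of the unit circle. -/
noncomputable def chord (t : UnitAddCircle) : ℝ := ‖(AddCircle.toCircle t : ℂ) - 1‖

/-- The longest side of the triangle inscribed in the unit circle with vertices
`1`, `e^{2πi z₀}`, `e^{2πi z₁}`. -/
noncomputable def longestSide (z : UnitAddTorus (Fin 2)) : ℝ :=
  max (max (chord (z 0)) (chord (z 1))) (chord (z 1 - z 0))

/-- The mean of `F` over the orbit of `x` under `(ℤ/d)ˣ`, the Galois group of the field of `d`-th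
roots of unity. -/
noncomputable def orbitMean (d : ℕ) [NeZero d] {X E : Type*} [SMul (ZMod d)ˣ X]
    [AddCommMonoid E] [Module ℝ E] (F : X → E) (x : X) : E :=
  (Nat.totient d : ℝ)⁻¹ • ∑ s : (ZMod d)ˣ, F (s • x)

/-- The point `v / d` of the torus, for a vector `v` of residues modulo `d`. -/
noncomputable def torsionPoint {d : ℕ} [NeZero d] (v : Fin 2 → ZMod d) : UnitAddTorus (Fin 2) :=
  fun i => ZMod.toAddCircle (v i)

section Roots
variable {d : ℕ} [NeZero d]

theorem chord_toAddCircle (t : ZMod d) :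
    chord (ZMod.toAddCircle t) = ‖(ZMod.stdAddChar t : ℂ) - 1‖ := rfl

theorem norm_stdAddChar_sub (s t : ZMod d) :
    ‖(ZMod.stdAddChar s : ℂ) - ZMod.stdAddChar t‖ = chord (ZMod.toAddCircle (s - t)) := by
  have h : (ZMod.stdAddChar s : ℂ) - ZMod.stdAddChar t =
      ZMod.stdAddChar t * (ZMod.stdAddChar (s - t) - 1) := by
    rw [mul_sub, ← AddChar.map_add_eq_mul, add_sub_cancel, mul_one]
  have h1 : ‖(ZMod.stdAddChar t : ℂ)‖ = 1 := Circle.norm_coe _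
  rw [h, norm_mul, h1, one_mul, chord_toAddCircle]

theorem stdAddChar_natCast_mul (k : ℕ) (t : ZMod d) :
    (ZMod.stdAddChar ((k : ZMod d) * t) : ℂ) = ZMod.stdAddChar t ^ k := by
  rw [← nsmul_eq_mul, AddChar.map_nsmul_eq_pow]

theorem isPrimitiveRoot_stdAddChar_one : IsPrimitiveRoot (ZMod.stdAddChar (1 : ZMod d) : ℂ) d := by
  have h := Complex.isPrimitiveRoot_exp d (NeZero.ne d)
  have h1 := ZMod.stdAddChar_coe (N := d) 1
  simp only [Int.cast_one, mul_one] at h1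
  rwa [h1]

/-- The primitive `d`-th roots of unity in `ℂ` are the numbers `e^{2πis/d}`, `s ∈ (ℤ/d)ˣ`. -/
theorem sum_primitiveRoots_complex {M : Type*} [AddCommMonoid M] (G : ℂ → M) :
    ∑ ξ ∈ primitiveRoots d ℂ, G ξ = ∑ s : (ZMod d)ˣ, G (ZMod.stdAddChar (s : ZMod d)) := by
  symm
  have hd : 0 < d := Nat.pos_of_ne_zero (NeZero.ne d)
  have hpr := isPrimitiveRoot_stdAddChar_one (d := d)
  refine Finset.sum_bij (fun s _ => ZMod.stdAddChar (s : ZMod d)) ?_ ?_ ?_ ?_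
  · intro s _
    rw [mem_primitiveRoots hd, hpr.isPrimitiveRoot_iff]
    refine ⟨(s : ZMod d).val, ZMod.val_lt _, ZMod.val_coe_unit_coprime s, ?_⟩
    rw [← stdAddChar_natCast_mul, mul_one, ZMod.natCast_zmod_val]
  · intro s _ t _ h
    exact Units.ext (ZMod.injective_stdAddChar h)
  · intro ξ hξ
    rw [mem_primitiveRoots hd, hpr.isPrimitiveRoot_iff] at hξ
    obtain ⟨k, _, hk, rfl⟩ := hξ
    refine ⟨ZMod.unitOfCoprime k hk, Finset.mem_univ _, ?_⟩
    rw [ZMod.coe_unitOfCoprime, ← stdAddChar_natCast_mul, mul_one]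
  · intro _ _
    rfl

variable {L : Type*} [Field L] [NumberField L]

/-- The complex embeddings of a cyclotomic field, parametrized by `(ℤ/d)ˣ`. -/
theorem sum_embeddings_cyclotomic [IsCyclotomicExtension {d} ℚ L] {ζ : L} (hζ : IsPrimitiveRoot ζ d)
    {M : Type*} [AddCommMonoid M] (G : ℂ → M) :
    ∑ τ : L →+* ℂ, G (τ ζ) = ∑ s : (ZMod d)ˣ, G (ZMod.stdAddChar (s : ZMod d)) := by
  rw [← sum_primitiveRoots_complex, ← Finset.sum_coe_sort (primitiveRoots d ℂ)]
  have hirr : Irreducible (Polynomial.cyclotomic d ℚ) :=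
    Polynomial.cyclotomic.irreducible_rat (Nat.pos_of_ne_zero (NeZero.ne d))
  refine Fintype.sum_equiv ((RingHom.equivRatAlgHom L ℂ).trans
    (hζ.embeddingsEquivPrimitiveRoots ℂ hirr)) _ _ fun τ => ?_
  rw [Equiv.trans_apply, IsPrimitiveRoot.embeddingsEquivPrimitiveRoots_apply_coe]
  rfl

theorem log_absNorm_span_singleton {x : NumberField.RingOfIntegers L} (hx : x ≠ 0) :
    Real.log (Ideal.absNorm (Ideal.span {x})) = ∑ τ : L →+* ℂ, Real.log ‖τ x‖ := by
  have h1 : (Ideal.absNorm (Ideal.span {x}) : ℝ) = ‖((Algebra.norm ℚ (x : L) : ℚ) : ℂ)‖ := by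
    rw [Ideal.absNorm_span_singleton, ← Algebra.coe_norm_int, Nat.cast_natAbs]
    simp
  have h2 : ((Algebra.norm ℚ (x : L) : ℚ) : ℂ) = ∏ τ : L →+* ℂ, τ x := by
    have := Algebra.norm_eq_prod_embeddings ℚ ℂ (x : L)
    rw [eq_ratCast] at this
    rw [this]
    exact (Fintype.prod_equiv (RingHom.equivRatAlgHom L ℂ) _ _ fun τ => rfl).symm
  rw [h1, h2, norm_prod, Real.log_prod]
  intro τ _
  rw [norm_ne_zero_iff, Ne, map_eq_zero]
  simpa using hx

/-- An ideal divides the principal ideal generated by each of its elements, so its norm is bounded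
by the norm of each nonzero generator. -/
theorem log_absNorm_span_range_bounds {ι : Type*} [Finite ι] {x : ι → NumberField.RingOfIntegers L}
    (i : ι) (hi : x i ≠ 0) :
    0 ≤ Real.log (Ideal.absNorm (Ideal.span (Set.range x))) ∧
      Real.log (Ideal.absNorm (Ideal.span (Set.range x))) ≤ ∑ τ : L →+* ℂ, Real.log ‖τ (x i)‖ := by
  rw [← log_absNorm_span_singleton hi]
  have hdvd : Ideal.absNorm (Ideal.span (Set.range x)) ∣ Ideal.absNorm (Ideal.span {x i}) :=
    Ideal.absNorm_dvd_absNorm_of_le (Ideal.span_mono (by rintro _ rfl; exact ⟨i, rfl⟩))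
  have hpos : 0 < Ideal.absNorm (Ideal.span {x i}) := by
    refine Nat.pos_of_ne_zero fun h => hi ?_
    rwa [Ideal.absNorm_eq_zero_iff, Ideal.span_singleton_eq_bot] at h
  have h1 : 0 < Ideal.absNorm (Ideal.span (Set.range x)) := Nat.pos_of_dvd_of_pos hdvd hpos
  refine ⟨Real.log_natCast_nonneg _, Real.log_le_log (by exact_mod_cast h1) ?_⟩
  exact_mod_cast Nat.le_of_dvd hpos hdvd

theorem Real.iSup_fin_three (f : Fin 3 → ℝ) : ⨆ i, f i = max (max (f 2) (f 1)) (f 0) := by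
  refine le_antisymm (ciSup_le fun i => ?_) (max_le (max_le ?_ ?_) ?_)
  · fin_cases i <;> simp
  all_goals exact le_ciSup (Set.finite_range f).bddAbove _

end Roots

/-- The height of `C ∩ ω C` agrees with its archimedean part, the orbit mean of the logarithm of
the longest side, up to a contribution of the finite places. The latter is controlled by any nonzero
one among the coordinates `1 - b` and `a - 1`. -/
theorem interHeight_bounds {d : ℕ} [NeZero d] {ζ : QBar} (hζ : IsPrimitiveRoot ζ d)
    (v : Fin 2 → ZMod d) (ω : Torus 2) (hω : ∀ i, (ω i : QBar)⁻¹ = ζ ^ (v i).val)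
    (i : Fin 2) (hi : v i ≠ 0) :
    |interHeight ω - orbitMean d (fun w => Real.log (longestSide (torsionPoint w))) v| ≤
      orbitMean d (fun t : ZMod d => Real.log (chord (ZMod.toAddCircle t))) (v i) := by
  have hcyc := hζ.intermediateField_adjoin_isCyclotomicExtension ℚ
  set L := IntermediateField.adjoin ℚ {ζ} with hL
  -- The two `ℚ`-algebra structures on `L` coincide by `Subsingleton`.
  have : @IsCyclotomicExtension {d} ℚ L _ _ DivisionRing.toRatAlgebra := by convert! hcyc
  have : NumberField L := IsCyclotomicExtension.numberField {d} ℚ L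
  let ζ' : L := ⟨ζ, IntermediateField.mem_adjoin_simple_self ℚ ζ⟩
  have hζ' : IsPrimitiveRoot ζ' d := by
    rw [← IsPrimitiveRoot.map_iff_of_injective (f := L.val) L.val.injective]
    exact hζ
  set z := hζ'.toInteger with hz
  have hzζ : ((z : NumberField.RingOfIntegers L) : L) = ζ' := rfl
  have hzp : IsPrimitiveRoot z d := hζ'.toInteger_isPrimitiveRoot
  have hne : ∀ j, v j ≠ 0 → z ^ (v j).val ≠ 1 := fun j hj =>
    hzp.pow_ne_one_of_pos_of_lt (by rwa [Ne, ZMod.val_eq_zero]) (ZMod.val_lt _)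
  have hω1 : ω ≠ 1 := by
    rintro rfl
    have h1 := hω i
    rw [Pi.one_apply, Units.val_one, inv_one] at h1
    exact hζ.pow_ne_one_of_pos_of_lt (by rwa [Ne, ZMod.val_eq_zero]) (ZMod.val_lt (v i)) h1.symm
  set a := z ^ (v 0).val with ha
  set b := z ^ (v 1).val with hb
  set x : Fin 3 → NumberField.RingOfIntegers L := ![b - a, 1 - b, a - 1] with hx
  obtain ⟨j, hj, hjn⟩ : ∃ j, x j ≠ 0 ∧ ∀ τ : L →+* ℂ, ‖τ (x j)‖ = ‖τ ζ' ^ (v i).val - 1‖ := by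
    fin_cases i
    · refine ⟨2, sub_ne_zero.2 (hne 0 hi), fun τ => ?_⟩
      simp [hx, ha, hzζ]
    · refine ⟨1, sub_ne_zero.2 (hne 1 hi).symm, fun τ => ?_⟩
      rw [norm_sub_rev]
      simp [hx, hb, hzζ]
  have hx0 : x ≠ 0 := Function.ne_iff.2 ⟨j, hj⟩
  have hfr : (Module.finrank ℚ L : ℝ) = d.totient := by
    rw [IsCyclotomicExtension.finrank (n := d) L
      (Polynomial.cyclotomic.irreducible_rat (Nat.pos_of_ne_zero (NeZero.ne d)))]
  have hpow : ∀ (s : (ZMod d)ˣ) (t : ZMod d),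
      (ZMod.stdAddChar (s : ZMod d) : ℂ) ^ t.val = ZMod.stdAddChar (s • t) := by
    intro s t
    rw [← stdAddChar_natCast_mul, ZMod.natCast_zmod_val, mul_comm, Units.smul_def, smul_eq_mul]
  have hheight : interHeight ω = orbitMean d (fun w => Real.log (longestSide (torsionPoint w))) v -
      (d.totient : ℝ)⁻¹ * Real.log (Ideal.absNorm (Ideal.span (Set.range x))) := by
    rw [interHeight_eq ω hω1, vecHeight_eq _ L (fun k => (x k : L)), logHeight_integral hx0, hfr,
      orbitMean, smul_eq_mul, div_eq_inv_mul, mul_sub]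
    · congr 2
      have hsum := sum_embeddings_cyclotomic hζ' (fun ξ => Real.log
        (max (max ‖ξ ^ (v 0).val - 1‖ ‖1 - ξ ^ (v 1).val‖) ‖ξ ^ (v 1).val - ξ ^ (v 0).val‖))
      convert hsum using 1
      · refine Finset.sum_congr rfl fun τ _ => ?_
        rw [Real.iSup_fin_three]
        simp [hx, ha, hb, hzζ]
      · refine Finset.sum_congr rfl fun s _ => ?_
        rw [hpow, hpow, norm_stdAddChar_sub, norm_sub_rev 1]
        simp only [longestSide, torsionPoint, Pi.smul_apply, chord_toAddCircle, ← map_sub]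
    · intro k
      rw [hω, hω]
      fin_cases k <;> simp [hx, ha, hb, hzζ] <;> rfl
  have hlog : orbitMean d (fun t : ZMod d => Real.log (chord (ZMod.toAddCircle t))) (v i) =
      (d.totient : ℝ)⁻¹ * ∑ τ : L →+* ℂ, Real.log ‖τ (x j)‖ := by
    simp_rw [hjn]
    rw [sum_embeddings_cyclotomic hζ' (fun ξ => Real.log ‖ξ ^ (v i).val - 1‖), orbitMean,
      smul_eq_mul]
    simp_rw [hpow]
    rfl
  obtain ⟨h0, h1⟩ := log_absNorm_span_range_bounds j hj
  rw [hheight, hlog, sub_sub_cancel_left, abs_neg, abs_of_nonneg (by positivity)]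
  gcongr

/-! ### Equidistribution of Galois orbits in the mean -/

/-- Every prime power dividing `n` is at most `2 φ(n)`. This crude bound suffices to see that `φ`
tends to infinity. -/
theorem Nat.le_two_mul_totient_factorial {n : ℕ} (hn : n ≠ 0) :
    n ≤ (2 * n.totient).factorial := by
  refine Nat.le_of_dvd (Nat.factorial_pos _) ?_
  rw [Nat.dvd_iff_prime_pow_dvd_dvd]
  intro p k hp hk
  refine Nat.dvd_factorial (pow_pos hp.pos k) ?_
  have h1 : (p ^ k).totient ≤ n.totient :=
    Nat.le_of_dvd (Nat.totient_pos.2 (Nat.pos_of_ne_zero hn)) (Nat.totient_dvd_of_dvd hk)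
  refine le_trans ?_ (Nat.mul_le_mul_left 2 h1)
  rcases k with _ | k
  · simp
  · rw [Nat.totient_prime_pow_succ hp, pow_succ]
    have : p ≤ 2 * (p - 1) := by have := hp.two_le; omega
    calc p ^ k * p ≤ p ^ k * (2 * (p - 1)) := Nat.mul_le_mul_left _ this
      _ = 2 * (p ^ k * (p - 1)) := by ring

theorem Nat.tendsto_totient_atTop : Tendsto Nat.totient atTop atTop := by
  refine tendsto_atTop.2 fun C => ?_
  filter_upwards [eventually_gt_atTop ((2 * C).factorial)] with n hn
  by_contra! h
  have h1 := Nat.le_two_mul_totient_factorial (n := n) (by omega)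
  have h2 : (2 * n.totient).factorial ≤ (2 * C).factorial := Nat.factorial_le (by omega)
  omega

/-- The number of solutions of `t * m = 0` modulo `d` is at most `m`. -/
theorem ZMod.card_mul_eq_zero_le {d : ℕ} [NeZero d] {m : ℤ} (hm : m ≠ 0) :
    (Finset.univ.filter fun t : ZMod d => t * m = 0).card ≤ m.natAbs := by
  have hd : 0 < d := Nat.pos_of_ne_zero (NeZero.ne d)
  have key : ∀ t : ZMod d, t * m = 0 → d ∣ t.val * m.natAbs := by
    intro t ht
    have h : (d : ℤ) ∣ t.val * m := by
      rw [← ZMod.intCast_zmod_eq_zero_iff_dvd]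
      push_cast
      rwa [ZMod.natCast_zmod_val]
    rwa [Int.natCast_dvd, Int.natAbs_mul, Int.natAbs_natCast] at h
  calc _ ≤ (Finset.range m.natAbs).card := by
        -- If `t * m = 0`, then `t.val * |m|` is a multiple of `d` less than `d * |m|`.
        refine Finset.card_le_card_of_injOn (fun t => t.val * m.natAbs / d) ?_ ?_
        · intro t _
          rw [Finset.coe_range, Set.mem_Iio]
          exact Nat.div_lt_of_lt_mul
            ((Nat.mul_lt_mul_right (Int.natAbs_pos.2 hm)).2 (ZMod.val_lt t))
        · intro t ht s hs h
          have ht' := key t (Finset.mem_filter.1 ht).2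
          have hs' := key s (Finset.mem_filter.1 hs).2
          have h' : t.val * m.natAbs = s.val * m.natAbs := by
            rw [← Nat.div_mul_cancel ht', ← Nat.div_mul_cancel hs']
            exact congrArg (· * d) h
          exact ZMod.val_injective d (Nat.eq_of_mul_eq_mul_right (Int.natAbs_pos.2 hm) h')
    _ = m.natAbs := Finset.card_range _

/-- The mean of `F` over the vectors of residues modulo `d`, that is, over the `d`-torsion points
of the torus. -/
noncomputable def torsionMean (d : ℕ) [NeZero d] (F : (Fin 2 → ZMod d) → ℝ) : ℝ :=
  ((d : ℝ) ^ 2)⁻¹ * ∑ v, F v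

section
variable {d : ℕ} [NeZero d]

theorem torsionMean_mono {F G : (Fin 2 → ZMod d) → ℝ} (h : ∀ v, F v ≤ G v) :
    torsionMean d F ≤ torsionMean d G :=
  mul_le_mul_of_nonneg_left (Finset.sum_le_sum fun v _ => h v) (by positivity)

theorem torsionMean_add (F G : (Fin 2 → ZMod d) → ℝ) :
    torsionMean d (fun v => F v + G v) = torsionMean d F + torsionMean d G := by
  rw [torsionMean, Finset.sum_add_distrib, mul_add]; rfl

theorem torsionMean_const_mul (c : ℝ) (F : (Fin 2 → ZMod d) → ℝ) :
    torsionMean d (fun v => c * F v) = c * torsionMean d F := by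
  rw [torsionMean, ← Finset.mul_sum, torsionMean]; ring

theorem torsionMean_const (c : ℝ) : torsionMean d (fun _ => c) = c := by
  have hd : (d : ℝ) ≠ 0 := Nat.cast_ne_zero.2 (NeZero.ne d)
  simp [torsionMean, ZMod.card, hd]

theorem torsionMean_le_sqrt (F : (Fin 2 → ZMod d) → ℝ) :
    torsionMean d F ≤ √(torsionMean d (fun v => F v ^ 2)) := by
  refine Real.le_sqrt_of_sq_le ?_
  have hd : (0 : ℝ) < (d : ℝ) ^ 2 := by
    have : (d : ℝ) ≠ 0 := Nat.cast_ne_zero.2 (NeZero.ne d)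
    positivity
  have h := sq_sum_le_card_mul_sum_sq (s := Finset.univ) (f := F)
  rw [Finset.card_univ, Fintype.card_pi_const, ZMod.card] at h
  push_cast at h
  rw [torsionMean, torsionMean, mul_pow]
  calc ((d : ℝ) ^ 2)⁻¹ ^ 2 * (∑ v, F v) ^ 2 ≤
        ((d : ℝ) ^ 2)⁻¹ ^ 2 * ((d : ℝ) ^ 2 * ∑ v, F v ^ 2) := by gcongr
    _ = _ := by field_simp

theorem inv_totient_mul_sum_const (c : ℝ) :
    (Nat.totient d : ℝ)⁻¹ * ∑ _s : (ZMod d)ˣ, c = c := by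
  have h : (Nat.totient d : ℝ) ≠ 0 :=
    Nat.cast_ne_zero.2 (Nat.totient_pos.2 (Nat.pos_of_ne_zero (NeZero.ne d))).ne'
  rw [Finset.sum_const, Finset.card_univ, ZMod.card_units_eq_totient, nsmul_eq_mul]
  field_simp

variable {X E : Type*} [SMul (ZMod d)ˣ X]

theorem norm_orbitMean_le [NormedAddCommGroup E] [NormedSpace ℝ E] (F : X → E) (x : X) :
    ‖orbitMean d F x‖ ≤ orbitMean d (fun y => ‖F y‖) x := by
  rw [orbitMean, orbitMean, norm_smul, smul_eq_mul, norm_inv, Real.norm_natCast]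
  gcongr
  exact norm_sum_le _ _

theorem orbitMean_mono {F G : X → ℝ} (h : ∀ y, F y ≤ G y) (x : X) :
    orbitMean d F x ≤ orbitMean d G x := by
  rw [orbitMean, orbitMean, smul_eq_mul, smul_eq_mul]
  gcongr
  exact h _

theorem orbitMean_const [NormedAddCommGroup E] [NormedSpace ℝ E] (c : E) (x : X) :
    orbitMean d (fun _ : X => c) x = c := by
  have h : (Nat.totient d : ℝ) ≠ 0 :=
    Nat.cast_ne_zero.2 (Nat.totient_pos.2 (Nat.pos_of_ne_zero (NeZero.ne d))).ne'
  rw [orbitMean, Finset.sum_const, Finset.card_univ, ZMod.card_units_eq_totient,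
    ← Nat.cast_smul_eq_nsmul ℝ, smul_smul, inv_mul_cancel₀ h, one_smul]

theorem orbitMean_add [NormedAddCommGroup E] [NormedSpace ℝ E] (F G : X → E) (x : X) :
    orbitMean d (fun y => F y + G y) x = orbitMean d F x + orbitMean d G x := by
  rw [orbitMean, Finset.sum_add_distrib, smul_add]; rfl

theorem orbitMean_sub [NormedAddCommGroup E] [NormedSpace ℝ E] (F G : X → E) (x : X) :
    orbitMean d (fun y => F y - G y) x = orbitMean d F x - orbitMean d G x := by
  rw [orbitMean, Finset.sum_sub_distrib, smul_sub]; rfl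

/-- Since the units permute any invariant finite set, an orbit mean has the same sum as the
function itself. -/
theorem sum_orbitMean {X : Type*} [MulAction (ZMod d)ˣ X] (S : Finset X)
    (hS : ∀ (s : (ZMod d)ˣ), ∀ x ∈ S, s • x ∈ S) (F : X → ℝ) :
    ∑ x ∈ S, orbitMean d F x = ∑ x ∈ S, F x := by
  simp_rw [orbitMean, smul_eq_mul]
  rw [← Finset.mul_sum, Finset.sum_comm]
  rw [Finset.sum_congr rfl (g := fun _ => ∑ x ∈ S, F x)]
  · exact inv_totient_mul_sum_const _
  · intro s _
    refine Finset.sum_bij' (fun x _ => s • x) (fun x _ => s⁻¹ • x) (fun x hx => hS s x hx)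
      (fun x hx => hS s⁻¹ x hx) ?_ ?_ ?_ <;> simp

theorem mFourier_torsionPoint (n : Fin 2 → ℤ) (v : Fin 2 → ZMod d) :
    UnitAddTorus.mFourier n (torsionPoint v) =
      ZMod.stdAddChar (∑ i, (n i : ZMod d) * v i) := by
  have h : ∀ i, fourier (n i) (torsionPoint v i) =
      (ZMod.stdAddChar ((n i : ZMod d) * v i) : ℂ) := fun i => by
    rw [fourier_apply, torsionPoint, ← map_zsmul, zsmul_eq_mul]
    rfl
  rw [Fin.sum_univ_two, AddChar.map_add_eq_mul, ← h, ← h]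
  exact Fin.prod_univ_two (fun i => (fourier (n i) (torsionPoint v i) : ℂ))

theorem norm_sum_stdAddChar_le (n : Fin 2 → ℤ) (i : Fin 2) (c : ZMod d) :
    ‖∑ v : Fin 2 → ZMod d, (ZMod.stdAddChar (c * ∑ i, (n i : ZMod d) * v i) : ℂ)‖ ≤
      if c * n i = 0 then (d : ℝ) ^ 2 else 0 := by
  split_ifs with h
  · refine (norm_sum_le _ _).trans (le_of_eq ?_)
    have : ∀ t : ZMod d, ‖(ZMod.stdAddChar t : ℂ)‖ = 1 := fun t => Circle.norm_coe _
    simp [this, ZMod.card]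
  · let φ : (Fin 2 → ZMod d) →+ ZMod d :=
      { toFun := fun v => c * ∑ i, (n i : ZMod d) * v i
        map_zero' := by simp
        map_add' := fun v w => by simp [mul_add, Finset.sum_add_distrib] }
    have hψ : (ZMod.stdAddChar (N := d)).compAddMonoidHom φ ≠ 0 := by
      intro h0
      apply h
      have h1 : (ZMod.stdAddChar (φ (Pi.single i 1)) : ℂ) = 1 := DFunLike.congr_fun h0 _
      rw [← AddChar.map_zero_eq_one (ZMod.stdAddChar (N := d))] at h1
      have h2 := ZMod.injective_stdAddChar h1
      have h3 : ∑ j, (n j : ZMod d) * (Pi.single i 1 : Fin 2 → ZMod d) j = n i := by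
        rw [Finset.sum_eq_single i] <;> simp +contextual
      rwa [← h3]
    have := AddChar.sum_eq_zero_iff_ne_zero.2 hψ
    rw [show ∑ v : Fin 2 → ZMod d, (ZMod.stdAddChar (c * ∑ i, (n i : ZMod d) * v i) : ℂ) = 0
      from this, norm_zero]

/-- Expanding the square, orthogonality of characters leaves only the pairs of units `s, t` with
`(t - s) nᵢ = 0`, of which there are at most `|nᵢ| φ(d)`. -/
theorem torsionMean_norm_sq_orbitMean_le (n : Fin 2 → ℤ) {i : Fin 2} (hi : n i ≠ 0) :
    torsionMean d (fun v => ‖orbitMean d (fun w => UnitAddTorus.mFourier n (torsionPoint w)) v‖ ^ 2)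
      ≤ (n i).natAbs / d.totient := by
  have htot : (0 : ℝ) < d.totient :=
    Nat.cast_pos.2 (Nat.totient_pos.2 (Nat.pos_of_ne_zero (NeZero.ne d)))
  have hd : (d : ℝ) ≠ 0 := Nat.cast_ne_zero.2 (NeZero.ne d)
  set k : (Fin 2 → ZMod d) → ZMod d := fun v => ∑ i, (n i : ZMod d) * v i with hk
  have h1 : ∀ v, ‖orbitMean d (fun w => UnitAddTorus.mFourier n (torsionPoint w)) v‖ ^ 2 =
      ((d.totient : ℝ)⁻¹) ^ 2 *
        ‖∑ s : (ZMod d)ˣ, (ZMod.stdAddChar ((s : ZMod d) * k v) : ℂ)‖ ^ 2 := by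
    intro v
    rw [orbitMean, norm_smul, norm_inv, Real.norm_natCast, mul_pow]
    congr 3
    refine Finset.sum_congr rfl fun s _ => ?_
    rw [mFourier_torsionPoint, hk, Finset.mul_sum]
    congr 1
    refine Finset.sum_congr rfl fun j _ => ?_
    rw [Pi.smul_apply, Units.smul_def, smul_eq_mul]
    ring
  have h2 : ∑ v, ‖∑ s : (ZMod d)ˣ, (ZMod.stdAddChar ((s : ZMod d) * k v) : ℂ)‖ ^ 2 ≤
      d.totient * ((n i).natAbs * (d : ℝ) ^ 2) := by
    have hsq : ∀ v, ((‖∑ s : (ZMod d)ˣ, (ZMod.stdAddChar ((s : ZMod d) * k v) : ℂ)‖ ^ 2 : ℝ) : ℂ) =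
        ∑ s : (ZMod d)ˣ, ∑ t : (ZMod d)ˣ,
          (ZMod.stdAddChar (((t : ZMod d) - (s : ZMod d)) * k v) : ℂ) := by
      intro v
      rw [Complex.ofReal_pow, ← Complex.conj_mul', map_sum, Finset.sum_mul_sum]
      refine Finset.sum_congr rfl fun s _ => Finset.sum_congr rfl fun t _ => ?_
      rw [← AddChar.map_neg_eq_conj, ← AddChar.map_add_eq_mul]
      congr 1
      ring
    have hc : ((∑ v, ‖∑ s : (ZMod d)ˣ, (ZMod.stdAddChar ((s : ZMod d) * k v) : ℂ)‖ ^ 2 : ℝ) : ℂ) =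
        ∑ s : (ZMod d)ˣ, ∑ t : (ZMod d)ˣ, ∑ v,
          (ZMod.stdAddChar (((t : ZMod d) - (s : ZMod d)) * k v) : ℂ) := by
      rw [Complex.ofReal_sum, Finset.sum_congr rfl fun v _ => hsq v, Finset.sum_comm]
      exact Finset.sum_congr rfl fun s _ => Finset.sum_comm
    calc _ = ‖((∑ v, ‖∑ s : (ZMod d)ˣ,
          (ZMod.stdAddChar ((s : ZMod d) * k v) : ℂ)‖ ^ 2 : ℝ) : ℂ)‖ := by
          rw [Complex.norm_real, Real.norm_of_nonneg (by positivity)]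
      _ ≤ ∑ s : (ZMod d)ˣ, ∑ t : (ZMod d)ˣ,
          if ((t : ZMod d) - (s : ZMod d)) * n i = 0 then (d : ℝ) ^ 2 else 0 := by
          rw [hc]
          refine (norm_sum_le _ _).trans (Finset.sum_le_sum fun s _ => ?_)
          refine (norm_sum_le _ _).trans (Finset.sum_le_sum fun t _ => ?_)
          exact norm_sum_stdAddChar_le n i _
      _ ≤ ∑ s : (ZMod d)ˣ, (n i).natAbs * (d : ℝ) ^ 2 := by
          refine Finset.sum_le_sum fun s _ => ?_
          rw [← Finset.sum_filter, Finset.sum_const, nsmul_eq_mul]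
          gcongr
          refine le_trans ?_ (ZMod.card_mul_eq_zero_le (d := d) hi)
          refine Finset.card_le_card_of_injOn (fun t => (t : ZMod d) - s) ?_ ?_
          · intro t ht
            simpa using ht
          · intro t _ t' _ h
            exact Units.ext (sub_left_injective h)
      _ = _ := by
          rw [Finset.sum_const, Finset.card_univ, ZMod.card_units_eq_totient, nsmul_eq_mul]
  simp_rw [h1]
  rw [torsionMean_const_mul, torsionMean]
  calc _ ≤ ((d.totient : ℝ)⁻¹) ^ 2 * (((d : ℝ) ^ 2)⁻¹ *
        (d.totient * ((n i).natAbs * (d : ℝ) ^ 2))) := by gcongr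
    _ = _ := by field_simp

end

theorem measureReal_univ_torus :
    (MeasureTheory.volume : MeasureTheory.Measure (UnitAddTorus (Fin 2))).real Set.univ = 1 := by
  rw [MeasureTheory.volume_pi, MeasureTheory.measureReal_def, MeasureTheory.Measure.pi_univ]
  simp

open MeasureTheory in
theorem integral_mFourier_eq_zero {n : Fin 2 → ℤ} (hn : n ≠ 0) :
    ∫ z, UnitAddTorus.mFourier n z = 0 := by
  obtain ⟨i, hi⟩ := Function.ne_iff.1 hn
  change ∫ z : UnitAddTorus (Fin 2), ∏ j, fourier (n j) (z j) = 0
  rw [integral_fintype_prod_volume_eq_prod (fun j (t : UnitAddCircle) => (fourier (n j) t : ℂ))]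
  refine Finset.prod_eq_zero (Finset.mem_univ i) ?_
  exact integral_eq_zero_of_add_right_eq_neg (fourier_add_half_inv_index hi zero_lt_one)

/-- The orbit means of `g` over the `d`-torsion points of the torus converge to the integral of `g`,
in mean over all these points, as `d` tends to infinity. -/
def OrbitEquidistributed (g : C(UnitAddTorus (Fin 2), ℂ)) : Prop :=
  ∀ ε > 0, ∀ᶠ d : ℕ in atTop, ∀ [NeZero d], torsionMean d
    (fun v => ‖orbitMean d (fun w => g (torsionPoint w)) v - ∫ z, g z‖) ≤ ε

theorem orbitEquidistributed_mFourier (n : Fin 2 → ℤ) :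
    OrbitEquidistributed (UnitAddTorus.mFourier n) := by
  intro ε hε
  rcases eq_or_ne n 0 with rfl | hn
  · refine Eventually.of_forall fun d _ => ?_
    simp only [UnitAddTorus.mFourier_zero, ContinuousMap.one_apply, orbitMean_const]
    simp [torsionMean_const, hε.le, measureReal_univ_torus]
  obtain ⟨i, hi⟩ := Function.ne_iff.1 hn
  have h1 : Tendsto (fun d : ℕ => ((n i).natAbs : ℝ) / d.totient) atTop (𝓝 0) :=
    Tendsto.div_atTop tendsto_const_nhds
      (tendsto_natCast_atTop_atTop.comp Nat.tendsto_totient_atTop)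
  filter_upwards [h1.eventually (gt_mem_nhds (pow_pos hε 2))] with d hd _
  simp only [integral_mFourier_eq_zero hn, sub_zero]
  refine (torsionMean_le_sqrt _).trans ?_
  rw [Real.sqrt_le_left hε.le]
  exact (torsionMean_norm_sq_orbitMean_le n hi).trans hd.le

open MeasureTheory in
theorem integrable_continuousMap_torus {E : Type*} [NormedAddCommGroup E]
    (g : C(UnitAddTorus (Fin 2), E)) : Integrable (fun z => g z) := by
  exact g.continuous.integrable_of_hasCompactSupport (HasCompactSupport.of_compactSpace _)

theorem OrbitEquidistributed.add {g h : C(UnitAddTorus (Fin 2), ℂ)}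
    (hg : OrbitEquidistributed g) (hh : OrbitEquidistributed h) : OrbitEquidistributed (g + h) := by
  intro ε hε
  filter_upwards [hg (ε / 2) (half_pos hε), hh (ε / 2) (half_pos hε)] with d h1 h2 _
  calc _ ≤ torsionMean d (fun v => ‖orbitMean d (fun w => g (torsionPoint w)) v - ∫ z, g z‖ +
        ‖orbitMean d (fun w => h (torsionPoint w)) v - ∫ z, h z‖) := by
        refine torsionMean_mono fun v => ?_
        simp only [ContinuousMap.add_apply]
        rw [orbitMean_add, MeasureTheory.integral_add (integrable_continuousMap_torus g)
          (integrable_continuousMap_torus h), add_sub_add_comm]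
        exact norm_add_le _ _
    _ ≤ ε := by
        rw [torsionMean_add]
        linarith [@h1 _, @h2 _]

theorem OrbitEquidistributed.smul {g : C(UnitAddTorus (Fin 2), ℂ)}
    (hg : OrbitEquidistributed g) (c : ℂ) : OrbitEquidistributed (c • g) := by
  intro ε hε
  have hc : 0 < ‖c‖ + 1 := by positivity
  filter_upwards [hg (ε / (‖c‖ + 1)) (by positivity)] with d h1 _
  calc _ = ‖c‖ * torsionMean d
        (fun v => ‖orbitMean d (fun w => g (torsionPoint w)) v - ∫ z, g z‖) := by
        rw [← torsionMean_const_mul]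
        congr 1
        ext v
        simp only [ContinuousMap.smul_apply]
        rw [MeasureTheory.integral_smul, ← norm_smul, smul_sub, orbitMean, orbitMean,
          ← Finset.smul_sum, smul_comm]
    _ ≤ (‖c‖ + 1) * (ε / (‖c‖ + 1)) := by
        gcongr
        · exact mul_nonneg (by positivity) (Finset.sum_nonneg fun _ _ => norm_nonneg _)
        · linarith
        · exact @h1 _
    _ = ε := by field_simp

/-- Trigonometric polynomials are dense, and the property is stable under uniform limits. -/
theorem orbitEquidistributed (g : C(UnitAddTorus (Fin 2), ℂ)) : OrbitEquidistributed g := by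
  have hspan : ∀ h ∈ Submodule.span ℂ (Set.range (UnitAddTorus.mFourier (d := Fin 2))),
      OrbitEquidistributed h := by
    intro h hh
    induction hh using Submodule.span_induction with
    | mem x hx =>
      obtain ⟨n, rfl⟩ := hx
      exact orbitEquidistributed_mFourier n
    | zero =>
      rw [← zero_smul ℂ (UnitAddTorus.mFourier (0 : Fin 2 → ℤ))]
      exact (orbitEquidistributed_mFourier 0).smul 0
    | add x y _ _ hx hy => exact hx.add hy
    | smul c x _ hx => exact hx.smul c
  intro ε hε
  have hmem : g ∈ (Submodule.span ℂ
      (Set.range (UnitAddTorus.mFourier (d := Fin 2)))).topologicalClosure := by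
    rw [UnitAddTorus.span_mFourier_closure_eq_top]; trivial
  obtain ⟨h, hh, hgh⟩ := Metric.mem_closure_iff.1 hmem (ε / 3) (by positivity)
  filter_upwards [hspan h hh (ε / 3) (by positivity)] with d h1 _
  have hpt : ∀ z, ‖(g - h) z‖ ≤ ε / 3 := fun z =>
    ((g - h).norm_coe_le_norm z).trans (by rw [← dist_eq_norm]; exact hgh.le)
  calc _ ≤ torsionMean d (fun v => ‖orbitMean d (fun w => h (torsionPoint w)) v - ∫ z, h z‖ +
        (ε / 3 + ε / 3)) := by
        refine torsionMean_mono fun v => ?_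
        have e1 : orbitMean d (fun w => g (torsionPoint w)) v - ∫ z, g z =
            (orbitMean d (fun w => h (torsionPoint w)) v - ∫ z, h z) +
              (orbitMean d (fun w => (g - h) (torsionPoint w)) v - ∫ z, (g - h) z) := by
          simp only [ContinuousMap.sub_apply]
          rw [orbitMean_sub, MeasureTheory.integral_sub (integrable_continuousMap_torus g)
            (integrable_continuousMap_torus h)]
          ring
        rw [e1]
        refine (norm_add_le _ _).trans (add_le_add le_rfl ((norm_sub_le _ _).trans ?_))
        refine add_le_add ((norm_orbitMean_le _ _).trans ?_) ?_
        · exact (orbitMean_mono (fun w => hpt _) v).trans (orbitMean_const _ _).le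
        · have := MeasureTheory.norm_integral_le_of_norm_le_const
            (μ := (MeasureTheory.volume : MeasureTheory.Measure (UnitAddTorus (Fin 2))))
            (Eventually.of_forall hpt)
          rwa [measureReal_univ_torus, mul_one] at this
    _ ≤ ε := by
        rw [torsionMean_add, torsionMean_const]
        linarith [@h1 _]

/-- The real-valued case of `orbitEquidistributed`. -/
theorem eventually_torsionMean_orbitMean_le (g : C(UnitAddTorus (Fin 2), ℝ)) {ε : ℝ} (hε : 0 < ε) :
    ∀ᶠ d : ℕ in atTop, ∀ [NeZero d], torsionMean d
      (fun v => |orbitMean d (fun w => g (torsionPoint w)) v - ∫ z, g z|) ≤ ε := by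
  filter_upwards [orbitEquidistributed
    (ContinuousMap.comp ⟨Complex.ofReal, Complex.continuous_ofReal⟩ g) ε hε] with d h _
  convert @h _ using 3 with v
  simp only [ContinuousMap.comp_apply, ContinuousMap.coe_mk]
  rw [integral_complex_ofReal, orbitMean, orbitMean, ← Complex.ofReal_sum, Complex.real_smul,
    ← Complex.ofReal_mul, ← Complex.ofReal_sub, Complex.norm_real]
  rfl

/-! ### The Fourier series of the logarithm of a chord -/

open Real in
theorem chord_coe (x : ℝ) : chord (x : UnitAddCircle) = 2 * |sin (π * x)| := by
  rw [chord, AddCircle.toCircle_apply_mk, Circle.coe_exp, div_one]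
  have h := Complex.norm_exp_I_mul_ofReal_sub_one (2 * π * x)
  rw [mul_comm Complex.I] at h
  rw [h, norm_mul, Real.norm_eq_abs, Real.norm_eq_abs, abs_two]
  congr 3
  ring

theorem chord_nonneg (t : UnitAddCircle) : 0 ≤ chord t := norm_nonneg _

theorem chord_le_two (t : UnitAddCircle) : chord t ≤ 2 := by
  refine (norm_sub_le _ _).trans ?_
  rw [Circle.norm_coe, norm_one]; norm_num

theorem chord_neg (t : UnitAddCircle) : chord (-t) = chord t := by
  have h1 : (AddCircle.toCircle (-t) : ℂ) - 1 =
      -(AddCircle.toCircle (-t) * ((AddCircle.toCircle t : ℂ) - 1)) := by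
    rw [mul_sub, ← Circle.coe_mul, ← AddCircle.toCircle_add, neg_add_cancel,
      AddCircle.toCircle_zero]
    simp
  rw [chord, h1, norm_neg, norm_mul, Circle.norm_coe, one_mul, chord]

theorem continuous_chord : Continuous chord := by
  unfold chord
  exact ((continuous_subtype_val.comp AddCircle.continuous_toCircle).sub continuous_const).norm

theorem chord_eq_zero {t : UnitAddCircle} : chord t = 0 ↔ t = 0 := by
  rw [chord, norm_eq_zero, sub_eq_zero, Circle.coe_eq_one, ← AddCircle.toCircle_zero (T := 1),
    (AddCircle.injective_toCircle one_ne_zero).eq_iff]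

theorem chord_pos {t : UnitAddCircle} (ht : t ≠ 0) : 0 < chord t :=
  (chord_nonneg t).lt_of_ne fun h => ht (chord_eq_zero.1 h.symm)

/-- The logarithm of the chord, as a `1`-periodic function on `ℝ`; it takes the junk value `0` at
the integers, where the chord vanishes. -/
noncomputable def logChord (x : ℝ) : ℝ := Real.log (chord (x : UnitAddCircle))

theorem chord_coe_pos {x : ℝ} (h0 : 0 < x) (h1 : x < 1) : 0 < chord (x : UnitAddCircle) := by
  have : 0 < Real.sin (Real.pi * x) := Real.sin_pos_of_pos_of_lt_pi (by positivity)
    (by nlinarith [Real.pi_pos])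
  rw [chord_coe]; positivity

open Real in
theorem intervalIntegrable_logChord (a b : ℝ) :
    IntervalIntegrable logChord MeasureTheory.volume a b := by
  have h : logChord = fun x => log (2 * sin (π * x)) := by
    ext x
    rw [logChord, chord_coe, ← log_abs (2 * sin _), abs_mul, abs_two]
  rw [h]
  have : AnalyticOnNhd ℝ (fun x : ℝ => 2 * sin (π * x)) Set.univ := fun x _ => by fun_prop
  exact (MeromorphicOn.intervalIntegrable_log (f := fun x : ℝ => 2 * sin (π * x))
    fun x _ => (this x trivial).meromorphicAt)

theorem ae_chord_ne_zero : ∀ᵐ x : ℝ, chord (x : UnitAddCircle) ≠ 0 := by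
  have h : {x : ℝ | ¬ chord (x : UnitAddCircle) ≠ 0} ⊆ Set.range ((↑) : ℤ → ℝ) := by
    intro x hx
    rw [Set.mem_ofPred_eq, not_not, chord_eq_zero, AddCircle.coe_eq_zero_iff] at hx
    obtain ⟨n, hn⟩ := hx
    exact ⟨n, by simpa using hn⟩
  exact MeasureTheory.measure_mono_null h ((Set.countable_range _).measure_zero _)

theorem continuousAt_logChord {x : ℝ} (hx : chord (x : UnitAddCircle) ≠ 0) :
    ContinuousAt logChord x := by
  refine ContinuousAt.log ?_ hx
  exact (continuous_chord.comp (AddCircle.continuous_mk' 1)).continuousAt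

section Regularized
open Real

/-- Inside the unit disc the Fourier series of the logarithm comes from the Taylor series
of `-log (1 - z)`. The term of index `0` vanishes, as a division by `0`. -/
theorem hasSum_log_norm_one_sub {r : ℝ} (h0 : 0 ≤ r) (h1 : r < 1) (x : ℝ) :
    HasSum (fun n : ℕ => -(r ^ n * cos (2 * π * n * x) / n))
      (log ‖1 - r * (AddCircle.toCircle (x : UnitAddCircle) : ℂ)‖) := by
  set z : ℂ := r * (AddCircle.toCircle (x : UnitAddCircle) : ℂ) with hz
  have hz1 : ‖z‖ < 1 := by
    rw [hz, norm_mul, Circle.norm_coe, mul_one, Complex.norm_real, norm_of_nonneg h0]; exact h1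
  have h := (Complex.hasSum_re (Complex.hasSum_taylorSeries_neg_log hz1)).neg
  rw [Complex.neg_re, neg_neg, Complex.log_re] at h
  convert! h using 2 with n
  have hc : (z ^ n / n).re = r ^ n * cos (2 * π * n * x) / n := by
    have hpow : z ^ n = ((r ^ n : ℝ) : ℂ) * Complex.exp ((2 * π * n * x : ℝ) * Complex.I) := by
      rw [hz, mul_pow, AddCircle.toCircle_apply_mk, Circle.coe_exp, ← Complex.exp_nat_mul]
      push_cast
      congr 2
      ring
    rw [hpow, ← Complex.ofReal_natCast, Complex.div_ofReal_re, Complex.re_ofReal_mul,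
      Complex.exp_ofReal_mul_I_re]
  rw [hc]

theorem integral_cos_two_pi_mul (n : ℕ) (x : ℝ) :
    ∫ t in (0 : ℝ)..x, cos (2 * π * n * t) / n = sin (2 * π * n * x) / (2 * π * n ^ 2) := by
  rcases eq_or_ne n 0 with rfl | hn
  · simp
  have hn' : (n : ℝ) ≠ 0 := Nat.cast_ne_zero.2 hn
  rw [intervalIntegral.integral_div, intervalIntegral.integral_comp_mul_left _ (by positivity),
    integral_cos]
  simp
  field_simp

theorem integral_sin_two_pi_mul (n : ℕ) (x : ℝ) :
    ∫ t in (0 : ℝ)..x, sin (2 * π * n * t) / (2 * π * n ^ 2) =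
      (1 - cos (2 * π * n * x)) / (4 * π ^ 2 * n ^ 3) := by
  rcases eq_or_ne n 0 with rfl | hn
  · simp
  have hn' : (n : ℝ) ≠ 0 := Nat.cast_ne_zero.2 hn
  rw [intervalIntegral.integral_div, intervalIntegral.integral_comp_mul_left _ (by positivity),
    integral_sin]
  simp
  field_simp
  ring

theorem hasSum_integral_log_norm_one_sub {r : ℝ} (h0 : 0 ≤ r) (h1 : r < 1) (x : ℝ) :
    HasSum (fun n : ℕ => -(r ^ n * (sin (2 * π * n * x) / (2 * π * n ^ 2))))
      (∫ t in (0 : ℝ)..x, log ‖1 - r * (AddCircle.toCircle (t : UnitAddCircle) : ℂ)‖) := by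
  have h := intervalIntegral.hasSum_integral_of_dominated_convergence
    (μ := MeasureTheory.volume) (a := 0) (b := x)
    (F := fun (n : ℕ) t => -(r ^ n * (cos (2 * π * n * t) / n)))
    (f := fun t => log ‖1 - r * (AddCircle.toCircle (t : UnitAddCircle) : ℂ)‖)
    (fun n _ => r ^ n)
    (fun n => by
      apply Continuous.aestronglyMeasurable
      fun_prop)
    (fun n => Eventually.of_forall fun t _ => by
      rw [norm_neg, norm_mul, norm_pow, norm_of_nonneg h0]
      refine mul_le_of_le_one_right (by positivity) ?_
      rw [norm_div, Real.norm_natCast, Real.norm_eq_abs]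
      rcases eq_or_ne n 0 with rfl | hn
      · simp
      · have : (1 : ℝ) ≤ n := by exact_mod_cast Nat.one_le_iff_ne_zero.2 hn
        exact div_le_one_of_le₀ ((abs_cos_le_one _).trans this) (by positivity))
    (Eventually.of_forall fun t _ => summable_geometric_of_lt_one h0 h1)
    intervalIntegrable_const
    (Eventually.of_forall fun t _ => by
      simpa only [mul_div_assoc] using hasSum_log_norm_one_sub h0 h1 t)
  convert! h using 2 with n
  rw [intervalIntegral.integral_neg, intervalIntegral.integral_const_mul, integral_cos_two_pi_mul]

/-- An integrable majorant of `log |1 - r e^{2πit}|`, uniform in `r`, which allows `r` to tend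
to `1`. -/
theorem abs_log_norm_one_sub_le {r : ℝ} (h0 : 0 ≤ r) (h1 : r < 1) {t : UnitAddCircle}
    (ht : chord t ≠ 0) :
    |log ‖1 - r * (AddCircle.toCircle t : ℂ)‖| ≤ log 2 + |log (chord t)| := by
  have hc : 0 < chord t := (chord_nonneg t).lt_of_ne ht.symm
  set w : ℂ := ((AddCircle.toCircle t : Circle) : ℂ) with hw
  have hw1 : ‖w‖ = 1 := Circle.norm_coe _
  have hrw : ‖(r : ℂ) * w‖ = r := by
    rw [norm_mul, hw1, mul_one, Complex.norm_real, norm_of_nonneg h0]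
  have hup : ‖1 - r * w‖ ≤ 2 := by
    refine (norm_sub_le _ _).trans ?_
    rw [hrw, norm_one]; linarith
  have hge : 1 - r ≤ ‖1 - r * w‖ := by
    have := norm_sub_norm_le (1 : ℂ) (r * w)
    rwa [hrw, norm_one] at this
  have hlow : chord t ≤ 2 * ‖1 - r * w‖ := by
    have h2 : w - 1 = -(1 - r * w) + (1 - r) * w := by ring
    have h3 : ‖((1 : ℂ) - r) * w‖ = 1 - r := by
      rw [norm_mul, hw1, mul_one, ← Complex.ofReal_one, ← Complex.ofReal_sub, Complex.norm_real,
        norm_of_nonneg (by linarith)]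
    calc chord t = ‖-(1 - r * w) + (1 - r) * w‖ := by rw [← h2]; rfl
      _ ≤ ‖1 - r * w‖ + (1 - r) := by
        refine (norm_add_le _ _).trans ?_
        rw [norm_neg, h3]
      _ ≤ _ := by linarith
  have hpos : 0 < ‖1 - r * w‖ := by linarith
  rw [abs_le]
  constructor
  · have h4 : log (chord t) ≤ log 2 + log ‖1 - r * w‖ := by
      rw [← log_mul two_ne_zero hpos.ne']
      exact log_le_log hc hlow
    linarith [neg_abs_le (log (chord t))]
  · have := log_le_log hpos hup
    linarith [abs_nonneg (log (chord t))]

theorem summable_one_div_natCast_pow (k : ℕ) (hk : 1 < k) : Summable fun n : ℕ => 1 / (n : ℝ) ^ k :=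
  Real.summable_one_div_nat_pow.2 hk

theorem abs_sin_div_le (n : ℕ) (x : ℝ) :
    |sin (2 * π * n * x) / (2 * π * n ^ 2)| ≤ 1 / (n : ℝ) ^ 2 := by
  rcases eq_or_ne n 0 with rfl | hn
  · simp
  have hn' : (0 : ℝ) < n := by positivity
  rw [abs_div, abs_of_pos (show 0 < 2 * π * (n : ℝ) ^ 2 by positivity)]
  refine div_le_div₀ zero_le_one (abs_sin_le_one _) (by positivity) ?_
  refine le_mul_of_one_le_left (by positivity) ?_
  linarith [pi_gt_three]

/-- The Fourier series of the primitive of `log |e^{2πit} - 1|`. -/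
theorem integral_logChord (x : ℝ) :
    ∫ t in (0 : ℝ)..x, logChord t = ∑' n : ℕ, -(sin (2 * π * n * x) / (2 * π * n ^ 2)) := by
  have hr : ∀ᶠ r : ℝ in 𝓝[<] 1, 0 ≤ r ∧ r < 1 := by
    filter_upwards [Ico_mem_nhdsLT (show (0 : ℝ) < 1 from one_pos)] with r hr using hr
  have hlim1 : Tendsto (fun r : ℝ => ∫ t in (0 : ℝ)..x,
      log ‖1 - r * (AddCircle.toCircle (t : UnitAddCircle) : ℂ)‖) (𝓝[<] 1)
      (𝓝 (∫ t in (0 : ℝ)..x, logChord t)) := by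
    refine intervalIntegral.tendsto_integral_filter_of_dominated_convergence
      (fun t => log 2 + |logChord t|) ?_ ?_ ?_ ?_
    · refine Eventually.of_forall fun r => ?_
      refine Measurable.aestronglyMeasurable (Real.measurable_log.comp ?_)
      refine Continuous.measurable ?_
      refine (continuous_const.sub (continuous_const.mul ?_)).norm
      exact continuous_subtype_val.comp
        (AddCircle.continuous_toCircle.comp (AddCircle.continuous_mk' 1))
    · filter_upwards [hr] with r hr
      filter_upwards [ae_chord_ne_zero] with t ht _
      exact abs_log_norm_one_sub_le hr.1 hr.2 ht
    · exact intervalIntegrable_const.add (intervalIntegrable_logChord _ _).abs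
    · filter_upwards [ae_chord_ne_zero] with t ht _
      have hc : ContinuousAt
          (fun r : ℝ => ‖1 - r * (AddCircle.toCircle (t : UnitAddCircle) : ℂ)‖) 1 := by
        fun_prop
      have h1 : ‖1 - ((1 : ℝ) : ℂ) * (AddCircle.toCircle (t : UnitAddCircle) : ℂ)‖ = chord t := by
        rw [Complex.ofReal_one, one_mul, norm_sub_rev, chord]
      have := (hc.log (by rwa [h1])).tendsto
      rw [h1] at this
      exact this.mono_left nhdsWithin_le_nhds
  have hlim2 : Tendsto (fun r : ℝ => ∑' n : ℕ, -(r ^ n * (sin (2 * π * n * x) / (2 * π * n ^ 2))))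
      (𝓝[<] 1) (𝓝 (∑' n : ℕ, -(sin (2 * π * n * x) / (2 * π * n ^ 2)))) := by
    refine tendsto_tsum_of_dominated_convergence (summable_one_div_natCast_pow 2 one_lt_two) ?_ ?_
    · intro n
      have hc : ContinuousAt
          (fun r : ℝ => -(r ^ n * (sin (2 * π * n * x) / (2 * π * n ^ 2)))) 1 := by
        fun_prop
      have := hc.tendsto
      simp only [one_pow, one_mul] at this
      exact this.mono_left nhdsWithin_le_nhds
    · filter_upwards [hr] with r hr n
      rw [norm_neg, norm_mul, norm_pow, norm_of_nonneg hr.1]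
      exact (mul_le_of_le_one_left (norm_nonneg _) (pow_le_one₀ hr.1 hr.2.le)).trans
        (abs_sin_div_le n x)
  -- Both sides are the limits at `r = 1` of the corresponding identity inside the unit disc.
  refine tendsto_nhds_unique hlim1 (hlim2.congr' ?_)
  filter_upwards [hr] with r hr
  exact (hasSum_integral_log_norm_one_sub hr.1 hr.2 x).tsum_eq

/-- The Fourier series of the second primitive of `log |e^{2πit} - 1|`. -/
theorem integral_integral_logChord (x : ℝ) :
    ∫ y in (0 : ℝ)..x, (∫ t in (0 : ℝ)..y, logChord t) =
      ∑' n : ℕ, -((1 - cos (2 * π * n * x)) / (4 * π ^ 2 * n ^ 3)) := by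
  have h := intervalIntegral.hasSum_integral_of_dominated_convergence
    (μ := MeasureTheory.volume) (a := 0) (b := x)
    (F := fun (n : ℕ) t => -(sin (2 * π * n * t) / (2 * π * n ^ 2)))
    (f := fun y => ∫ t in (0 : ℝ)..y, logChord t)
    (fun n _ => 1 / (n : ℝ) ^ 2)
    (fun n => by
      apply Continuous.aestronglyMeasurable
      fun_prop)
    (fun n => Eventually.of_forall fun t _ => by
      rw [norm_neg]; exact abs_sin_div_le n t)
    (Eventually.of_forall fun t _ => summable_one_div_natCast_pow 2 one_lt_two)
    intervalIntegrable_const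
    (Eventually.of_forall fun t _ => by
      rw [integral_logChord]
      refine Summable.hasSum (Summable.of_norm_bounded
        (summable_one_div_natCast_pow 2 one_lt_two) fun n => ?_)
      rw [norm_neg]; exact abs_sin_div_le n t)
  rw [← h.tsum_eq]
  refine tsum_congr fun n => ?_
  rw [intervalIntegral.integral_neg, integral_sin_two_pi_mul]

theorem zeta_three_re : (riemannZeta 3).re = ∑' n : ℕ, 1 / (n : ℝ) ^ 3 := by
  have h := zeta_nat_eq_tsum_of_gt_one (k := 3) (by norm_num)
  have h' : riemannZeta 3 = ((∑' n : ℕ, 1 / (n : ℝ) ^ 3 : ℝ) : ℂ) := by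
    push_cast; exact_mod_cast h
  rw [h', Complex.ofReal_re]

/-- The part of the series for `ζ(3)` over the multiples of `m`. -/
theorem hasSum_ite_dvd_zeta_three {m : ℕ} (hm : m ≠ 0) :
    HasSum (fun n : ℕ => if m ∣ n then 1 / (n : ℝ) ^ 3 else 0)
      ((riemannZeta 3).re / (m : ℝ) ^ 3) := by
  have hinj : Function.Injective (fun k : ℕ => m * k) := fun a b h =>
    Nat.eq_of_mul_eq_mul_left (Nat.pos_of_ne_zero hm) h
  rw [← hinj.hasSum_iff]
  · have h : HasSum (fun n : ℕ => 1 / (n : ℝ) ^ 3) (riemannZeta 3).re := by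
      rw [zeta_three_re]; exact (summable_one_div_natCast_pow 3 (by norm_num)).hasSum
    convert! h.div_const ((m : ℝ) ^ 3) using 2 with n
    simp only [Function.comp_apply, dvd_mul_right, if_true]
    push_cast
    rw [mul_pow, div_div, mul_comm]
  · intro n hn
    rw [if_neg]
    rintro ⟨k, rfl⟩
    exact hn ⟨k, rfl⟩

/-- If `cos (2πnx)` depends only on whether `m` divides `n`, then the second primitive at `x` is an
elementary multiple of `ζ(3) / π²`. -/
theorem integral_integral_logChord_of_cos {x α β : ℝ} {m : ℕ} (hm : m ≠ 0)
    (h : ∀ n : ℕ, 1 - cos (2 * π * n * x) = α - if m ∣ n then β else 0) :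
    ∫ y in (0 : ℝ)..x, (∫ t in (0 : ℝ)..y, logChord t) =
      -(α - β / (m : ℝ) ^ 3) * (riemannZeta 3).re / (4 * π ^ 2) := by
  have h1 := ((hasSum_ite_dvd_zeta_three one_ne_zero).mul_left α).sub
    ((hasSum_ite_dvd_zeta_three hm).mul_left β)
  have h2 := (h1.mul_left (-(4 * π ^ 2)⁻¹)).tsum_eq
  rw [integral_integral_logChord]
  trans (-(4 * π ^ 2)⁻¹ * (α * ((riemannZeta 3).re / ((1 : ℕ) : ℝ) ^ 3) -
    β * ((riemannZeta 3).re / (m : ℝ) ^ 3)))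
  · rw [← h2]
    refine tsum_congr fun n => ?_
    rw [h n]
    split_ifs with h3 h4 <;> simp_all <;> field_simp
  · field_simp
    simp

theorem cos_two_pi_mul_half (n : ℕ) :
    1 - cos (2 * π * n * (1 / 2)) = 2 - if 2 ∣ n then 2 else 0 := by
  rw [show 2 * π * n * (1 / 2) = n * π by ring, cos_nat_mul_pi]
  rcases Nat.even_or_odd n with h | h
  · rw [h.neg_one_pow, if_pos h.two_dvd]; norm_num
  · rw [h.neg_one_pow, if_neg (fun h' => (Nat.not_even_iff_odd.2 h) (even_iff_two_dvd.2 h'))]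
    norm_num

theorem cos_two_pi_mul_third (n : ℕ) :
    1 - cos (2 * π * n * (1 / 3)) = 3 / 2 - if 3 ∣ n then 3 / 2 else 0 := by
  have hc1 : cos (2 * π / 3) = -(1 / 2) := by
    rw [show 2 * π / 3 = π - π / 3 by ring, cos_pi_sub, cos_pi_div_three]
  have hc2 : cos (4 * π / 3) = -(1 / 2) := by
    rw [show 4 * π / 3 = π / 3 + π by ring, cos_add_pi, cos_pi_div_three]
  obtain ⟨k, hk | hk | hk⟩ : ∃ k, n = 3 * k ∨ n = 3 * k + 1 ∨ n = 3 * k + 2 :=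
    ⟨n / 3, by omega⟩
  · rw [if_pos (by omega), hk,
      show 2 * π * ((3 * k : ℕ) : ℝ) * (1 / 3) = k * (2 * π) by push_cast; ring,
      cos_nat_mul_two_pi]; norm_num
  · rw [if_neg (by omega), hk,
      show 2 * π * ((3 * k + 1 : ℕ) : ℝ) * (1 / 3) = 2 * π / 3 + k * (2 * π) by push_cast; ring,
      cos_add_nat_mul_two_pi, hc1]; norm_num
  · rw [if_neg (by omega), hk,
      show 2 * π * ((3 * k + 2 : ℕ) : ℝ) * (1 / 3) = 4 * π / 3 + k * (2 * π) by push_cast; ring,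
      cos_add_nat_mul_two_pi, hc2]; norm_num

theorem cos_two_pi_mul_two_thirds (n : ℕ) :
    1 - cos (2 * π * n * (2 / 3)) = 3 / 2 - if 3 ∣ n then 3 / 2 else 0 := by
  rw [← cos_two_pi_mul_third, ← cos_nat_mul_two_pi_sub (2 * π * n * (1 / 3)) n]
  congr 2
  ring

theorem integral_integral_logChord_half :
    ∫ y in (0 : ℝ)..(1 / 2), (∫ t in (0 : ℝ)..y, logChord t) =
      -(7 / 4) * (riemannZeta 3).re / (4 * π ^ 2) := by
  rw [integral_integral_logChord_of_cos two_ne_zero cos_two_pi_mul_half]; norm_num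

theorem integral_integral_logChord_third :
    ∫ y in (0 : ℝ)..(1 / 3), (∫ t in (0 : ℝ)..y, logChord t) =
      -(13 / 9) * (riemannZeta 3).re / (4 * π ^ 2) := by
  rw [integral_integral_logChord_of_cos three_ne_zero cos_two_pi_mul_third]; norm_num

theorem integral_integral_logChord_two_thirds :
    ∫ y in (0 : ℝ)..(2 / 3), (∫ t in (0 : ℝ)..y, logChord t) =
      -(13 / 9) * (riemannZeta 3).re / (4 * π ^ 2) := by
  rw [integral_integral_logChord_of_cos three_ne_zero cos_two_pi_mul_two_thirds]; norm_num

theorem integral_logChord_half : ∫ t in (0 : ℝ)..(1 / 2), logChord t = 0 := by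
  rw [integral_logChord]
  refine (tsum_congr fun n => ?_).trans tsum_zero
  rw [show 2 * π * n * (1 / 2) = n * π by ring, sin_nat_mul_pi]; simp

theorem integral_logChord_one : ∫ t in (0 : ℝ)..1, logChord t = 0 := by
  rw [integral_logChord]
  refine (tsum_congr fun n => ?_).trans tsum_zero
  rw [show 2 * π * n * 1 = (2 * n : ℕ) * π by push_cast; ring, sin_nat_mul_pi]; simp

end Regularized

/-! ### The mean of the logarithm of the longest side -/

theorem longestSide_coe (x y : ℝ) : longestSide ![(x : UnitAddCircle), (y : UnitAddCircle)] =
    max (max (chord (x : UnitAddCircle)) (chord (y : UnitAddCircle)))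
      (chord ((y - x : ℝ) : UnitAddCircle)) := rfl

theorem chord_coe_neg (x : ℝ) : chord ((-x : ℝ) : UnitAddCircle) = chord (x : UnitAddCircle) := by
  rw [AddCircle.coe_neg, chord_neg]

theorem chord_one_sub (x : ℝ) :
    chord ((1 - x : ℝ) : UnitAddCircle) = chord (x : UnitAddCircle) := by
  rw [AddCircle.coe_sub, AddCircle.coe_period, zero_sub, chord_neg]

theorem chord_one_add (x : ℝ) :
    chord ((1 + x : ℝ) : UnitAddCircle) = chord (x : UnitAddCircle) := by
  rw [AddCircle.coe_add, AddCircle.coe_period, zero_add]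

open Real in
/-- The chord is increasing in the distance to the nearest integer. -/
theorem chord_le_chord {u w : ℝ} (h0 : 0 ≤ u) (h1 : u ≤ w) (h2 : w ≤ 1 - u) :
    chord (u : UnitAddCircle) ≤ chord (w : UnitAddCircle) := by
  have mono : ∀ {a b : ℝ}, 0 ≤ a → a ≤ b → b ≤ 1 / 2 →
      chord (a : UnitAddCircle) ≤ chord (b : UnitAddCircle) := by
    intro a b ha hab hb
    have hpi := pi_pos
    have hsa : 0 ≤ sin (π * a) := sin_nonneg_of_nonneg_of_le_pi (by positivity) (by nlinarith)
    have hs : sin (π * a) ≤ sin (π * b) :=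
      sin_le_sin_of_le_of_le_pi_div_two (by nlinarith) (by nlinarith) (by nlinarith)
    rw [chord_coe, chord_coe, abs_of_nonneg hsa, abs_of_nonneg (hsa.trans hs)]
    linarith
  rcases le_total w (1 / 2) with hw | hw
  · exact mono h0 h1 hw
  · rw [← chord_one_sub w]
    exact mono h0 (by linarith) (by linarith)

/-- Reflecting the triangle in the perpendicular bisector of the side from `1` to `e^{2πix}`. -/
theorem longestSide_symm (x y : ℝ) :
    longestSide ![(x : UnitAddCircle), ((1 + x - y : ℝ) : UnitAddCircle)] =
      longestSide ![(x : UnitAddCircle), (y : UnitAddCircle)] := by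
  rw [longestSide_coe, longestSide_coe, show 1 + x - y - x = 1 - y by ring, chord_one_sub,
    show 1 + x - y = 1 + -(y - x) by ring, chord_one_add, chord_coe_neg]
  rw [max_assoc, max_comm (chord ((y - x : ℝ) : UnitAddCircle)), ← max_assoc]

/-- Complex conjugation does not change the sides of the triangle. -/
theorem longestSide_one_sub (x y : ℝ) :
    longestSide ![((1 - x : ℝ) : UnitAddCircle), ((1 - y : ℝ) : UnitAddCircle)] =
      longestSide ![(x : UnitAddCircle), (y : UnitAddCircle)] := by
  rw [longestSide_coe, longestSide_coe, show 1 - y - (1 - x) = -(y - x) by ring, chord_one_sub,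
    chord_one_sub, chord_coe_neg]

/-- The logarithm of the longest side, in real coordinates on the torus. -/
noncomputable def logSide (x y : ℝ) : ℝ :=
  Real.log (longestSide ![(x : UnitAddCircle), (y : UnitAddCircle)])

theorem chord_le_longestSide (z : UnitAddTorus (Fin 2)) : ∀ i, chord (z i) ≤ longestSide z := by
  intro i
  fin_cases i
  · exact (le_max_left _ _).trans (le_max_left _ _)
  · exact (le_max_right _ _).trans (le_max_left _ _)

theorem continuous_longestSide : Continuous longestSide := by
  unfold longestSide
  have := continuous_chord
  fun_prop

theorem continuous_logSide {x : ℝ} (h0 : 0 < x) (h1 : x < 1) : Continuous (logSide x) := by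
  refine Continuous.log ?_ fun y => ?_
  · refine continuous_longestSide.comp (continuous_pi fun i => ?_)
    fin_cases i
    · exact continuous_const
    · exact AddCircle.continuous_mk' 1
  · exact ((chord_coe_pos h0 h1).trans_le
      (chord_le_longestSide ![(x : UnitAddCircle), (y : UnitAddCircle)] 0)).ne'

theorem logSide_of_le {x y : ℝ} (h0 : 0 ≤ y) (h1 : y ≤ x) (h2 : x ≤ 1 / 2) :
    logSide x y = logChord x := by
  rw [logSide, longestSide_coe, logChord, max_eq_left (chord_le_chord h0 h1 (by linarith)),
    max_eq_left]
  rw [show y - x = -(x - y) by ring, chord_coe_neg]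
  exact chord_le_chord (by linarith) (by linarith) (by linarith)

theorem logSide_of_le_one_sub {x y : ℝ} (h0 : 0 ≤ x) (h1 : x ≤ y) (h2 : y ≤ (1 + x) / 2)
    (h3 : y ≤ 1 - x) : logSide x y = logChord y := by
  rw [logSide, longestSide_coe, logChord, max_eq_right (chord_le_chord h0 h1 h3), max_eq_left]
  exact chord_le_chord (by linarith) (by linarith) (by linarith)

theorem logSide_of_one_sub_le {x y : ℝ} (h0 : 0 ≤ x) (h1 : x ≤ y) (h2 : y ≤ (1 + x) / 2)
    (h3 : 1 - x ≤ y) : logSide x y = logChord x := by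
  have h5 : chord (y : UnitAddCircle) ≤ chord (x : UnitAddCircle) := by
    rw [← chord_one_sub y]
    exact chord_le_chord (by linarith) (by linarith) (by linarith)
  rw [logSide, longestSide_coe, logChord, max_eq_left h5, max_eq_left]
  exact (chord_le_chord (w := y) (by linarith) (by linarith) (by linarith)).trans h5

/-- For `y ≤ x` the longest side is the chord at `x`; the rest of the integral is symmetric about
`y = (1 + x) / 2`. -/
theorem integral_logSide_split {x : ℝ} (h0 : 0 < x) (h1 : x ≤ 1 / 2) :
    ∫ y in (0 : ℝ)..1, logSide x y =
      x * logChord x + 2 * ∫ y in x..((1 + x) / 2), logSide x y := by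
  have hc := continuous_logSide h0 (by linarith)
  have hI : ∀ a b, IntervalIntegrable (logSide x) MeasureTheory.volume a b :=
    fun a b => hc.intervalIntegrable a b
  have e1 : ∫ y in (0 : ℝ)..x, logSide x y = x * logChord x := by
    rw [intervalIntegral.integral_congr (g := fun _ => logChord x)]
    · rw [intervalIntegral.integral_const, sub_zero, smul_eq_mul]
    · intro y hy
      rw [Set.uIcc_of_le h0.le] at hy
      exact logSide_of_le hy.1 hy.2 h1
  -- The reflection `y ↦ 1 + x - y` exchanges the two halves of `[x, 1]`.
  have e2 : ∫ y in ((1 + x) / 2)..1, logSide x y = ∫ y in x..((1 + x) / 2), logSide x y := by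
    have h := intervalIntegral.integral_comp_sub_left (a := x) (b := (1 + x) / 2)
      (logSide x) (1 + x)
    rw [show 1 + x - (1 + x) / 2 = (1 + x) / 2 by ring, show 1 + x - x = 1 by ring] at h
    rw [← h]
    refine intervalIntegral.integral_congr fun y _ => ?_
    simp only [logSide, longestSide_symm]
  rw [← intervalIntegral.integral_add_adjacent_intervals (hI 0 x) (hI x 1),
    ← intervalIntegral.integral_add_adjacent_intervals (hI x ((1 + x) / 2)) (hI _ 1), e1, e2]
  ring

theorem integral_logChord_sub (a b : ℝ) : ∫ t in a..b, logChord t =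
    (∫ t in (0 : ℝ)..b, logChord t) - ∫ t in (0 : ℝ)..a, logChord t :=
  (intervalIntegral.integral_interval_sub_left (intervalIntegrable_logChord _ _)
    (intervalIntegrable_logChord _ _)).symm

theorem integral_logSide_of_le_third {x : ℝ} (h0 : 0 < x) (h1 : x ≤ 1 / 3) :
    ∫ y in (0 : ℝ)..1, logSide x y = x * logChord x +
      2 * ((∫ t in (0 : ℝ)..((1 + x) / 2), logChord t) - ∫ t in (0 : ℝ)..x, logChord t) := by
  rw [integral_logSide_split h0 (by linarith), ← integral_logChord_sub]
  congr 2
  refine intervalIntegral.integral_congr fun y hy => ?_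
  rw [Set.uIcc_of_le (by linarith)] at hy
  exact logSide_of_le_one_sub h0.le hy.1 hy.2 (by linarith [hy.2])

theorem integral_logSide_of_third_le {x : ℝ} (h1 : 1 / 3 ≤ x) (h2 : x ≤ 1 / 2) :
    ∫ y in (0 : ℝ)..1, logSide x y = (4 * x - 1) * logChord x +
      2 * ((∫ t in (0 : ℝ)..(1 - x), logChord t) - ∫ t in (0 : ℝ)..x, logChord t) := by
  have h0 : 0 < x := by linarith
  have hc := continuous_logSide h0 (by linarith)
  have e1 : ∫ y in x..(1 - x), logSide x y = ∫ y in x..(1 - x), logChord y := by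
    refine intervalIntegral.integral_congr fun y hy => ?_
    rw [Set.uIcc_of_le (by linarith)] at hy
    exact logSide_of_le_one_sub h0.le hy.1 (by linarith [hy.2]) hy.2
  have e2 : ∫ y in (1 - x)..((1 + x) / 2), logSide x y = (3 * x - 1) / 2 * logChord x := by
    rw [intervalIntegral.integral_congr (g := fun _ => logChord x)]
    · rw [intervalIntegral.integral_const, smul_eq_mul]
      ring
    · intro y hy
      rw [Set.uIcc_of_le (by linarith)] at hy
      exact logSide_of_one_sub_le h0.le (by linarith [hy.1]) hy.2 hy.1
  rw [integral_logSide_split h0 h2, ← integral_logChord_sub,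
    ← intervalIntegral.integral_add_adjacent_intervals (hc.intervalIntegrable x (1 - x))
      (hc.intervalIntegrable (1 - x) _), e1, e2]
  ring

theorem continuous_integral_logChord : Continuous fun x : ℝ => ∫ t in (0 : ℝ)..x, logChord t :=
  intervalIntegral.continuous_primitive intervalIntegrable_logChord 0

/-- Integration by parts, needed because the inner integral involves the chord at `x` with a linear
coefficient. -/
theorem integral_linear_mul_logChord (p q : ℝ) {a b : ℝ} (h0 : 0 ≤ a) (hab : a ≤ b) (h1 : b ≤ 1) :
    ∫ x in a..b, (p * x + q) * logChord x =
      (p * b + q) * (∫ t in (0 : ℝ)..b, logChord t) -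
        (p * a + q) * (∫ t in (0 : ℝ)..a, logChord t) -
        p * ∫ x in a..b, ∫ t in (0 : ℝ)..x, logChord t := by
  rw [intervalIntegral.integral_mul_deriv_eq_deriv_mul_of_hasDerivAt (u := fun x => p * x + q)
    (u' := fun _ => p) (v := fun x => ∫ t in (0 : ℝ)..x, logChord t) (v' := logChord),
    intervalIntegral.integral_const_mul]
  · fun_prop
  · exact continuous_integral_logChord.continuousOn
  · intro x _
    simpa using ((hasDerivAt_id x).const_mul p).add_const q
  · intro x hx
    rw [min_eq_left hab, max_eq_right hab] at hx
    have hx' := chord_coe_pos (h0.trans_lt hx.1) (hx.2.trans_le h1)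
    refine intervalIntegral.integral_hasDerivAt_right (intervalIntegrable_logChord _ _) ?_
      (continuousAt_logChord hx'.ne')
    exact MeasureTheory.AEStronglyMeasurable.stronglyMeasurableAtFilter
      (Real.measurable_log.comp (continuous_chord.measurable.comp
      (AddCircle.continuous_mk' 1).measurable)).aestronglyMeasurable
  · exact intervalIntegrable_const
  · exact intervalIntegrable_logChord _ _

theorem intervalIntegrable_linear_mul_logChord (p q a b : ℝ) :
    IntervalIntegrable (fun x => (p * x + q) * logChord x) MeasureTheory.volume a b :=
  (intervalIntegrable_logChord a b).continuousOn_mul (by fun_prop)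

open Real in
/-- The part of the double integral over `0 ≤ x ≤ 1/2`, which is half of it by conjugation. -/
theorem integral_logSide_half :
    IntervalIntegrable (fun x => ∫ y in (0 : ℝ)..1, logSide x y) MeasureTheory.volume 0 (1 / 2) ∧
    ∫ x in (0 : ℝ)..(1 / 2), ∫ y in (0 : ℝ)..1, logSide x y =
      2 * (riemannZeta 3).re / π ^ 2 := by
  set G : ℝ → ℝ := fun x => ∫ t in (0 : ℝ)..x, logChord t with hG
  have hGc : Continuous G := continuous_integral_logChord
  have hGi : ∀ a b, IntervalIntegrable G MeasureTheory.volume a b := fun a b =>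
    hGc.intervalIntegrable a b
  have hGsub : ∀ a b : ℝ, ∫ x in a..b, G x = (∫ x in (0 : ℝ)..b, G x) - ∫ x in (0 : ℝ)..a, G x :=
    fun a b => (intervalIntegral.integral_interval_sub_left (hGi _ _) (hGi _ _)).symm
  have c1 : Set.EqOn (fun x => ∫ y in (0 : ℝ)..1, logSide x y)
      (fun x => (1 * x + 0) * logChord x + 2 * (G ((1 + x) / 2) - G x)) (Set.uIoc 0 (1 / 3)) := by
    intro x hx
    rw [Set.uIoc_of_le (by norm_num)] at hx
    simp only [integral_logSide_of_le_third hx.1 hx.2, hG, one_mul, add_zero]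
  have c2 : Set.EqOn (fun x => ∫ y in (0 : ℝ)..1, logSide x y)
      (fun x => (4 * x + (-1)) * logChord x + 2 * (G (1 - x) - G x))
      (Set.uIoc (1 / 3) (1 / 2)) := by
    intro x hx
    rw [Set.uIoc_of_le (by norm_num)] at hx
    simp only [integral_logSide_of_third_le hx.1.le hx.2, hG]
    ring
  have d1 : Continuous fun x => 2 * (G ((1 + x) / 2) - G x) := by fun_prop
  have d2 : Continuous fun x => 2 * (G (1 - x) - G x) := by fun_prop
  have i1 : IntervalIntegrable (fun x => ∫ y in (0 : ℝ)..1, logSide x y) MeasureTheory.volume 0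
      (1 / 3) := by
    refine IntervalIntegrable.congr c1.symm ?_
    exact (intervalIntegrable_linear_mul_logChord _ _ _ _).add (d1.intervalIntegrable _ _)
  have i2 : IntervalIntegrable (fun x => ∫ y in (0 : ℝ)..1, logSide x y) MeasureTheory.volume
      (1 / 3) (1 / 2) := by
    refine IntervalIntegrable.congr c2.symm ?_
    exact (intervalIntegrable_linear_mul_logChord _ _ _ _).add (d2.intervalIntegrable _ _)
  refine ⟨i1.trans i2, ?_⟩
  have v1 : ∫ x in (0 : ℝ)..(1 / 3), G ((1 + x) / 2) = 2 * ∫ x in (1 / 2 : ℝ)..(2 / 3), G x := by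
    have h := intervalIntegral.integral_comp_mul_add (a := 0) (b := 1 / 3) G
      (c := 1 / 2) (by norm_num) (1 / 2)
    rw [show (1 / 2 : ℝ) * 0 + 1 / 2 = 1 / 2 by norm_num,
      show (1 / 2 : ℝ) * (1 / 3) + 1 / 2 = 2 / 3 by norm_num, smul_eq_mul,
      show (1 / 2 : ℝ)⁻¹ = 2 by norm_num] at h
    rw [← h]
    refine intervalIntegral.integral_congr fun x _ => ?_
    exact congrArg G (by ring)
  have v2 : ∫ x in (1 / 3 : ℝ)..(1 / 2), G (1 - x) = ∫ x in (1 / 2 : ℝ)..(2 / 3), G x := by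
    rw [intervalIntegral.integral_comp_sub_left G 1]
    norm_num
  have w1 : ∫ x in (0 : ℝ)..(1 / 3), ∫ y in (0 : ℝ)..1, logSide x y =
      (1 * (1 / 3) + 0) * G (1 / 3) - (∫ x in (0 : ℝ)..(1 / 3), G x) +
        2 * (2 * (∫ x in (1 / 2 : ℝ)..(2 / 3), G x) - ∫ x in (0 : ℝ)..(1 / 3), G x) := by
    rw [intervalIntegral.integral_congr_ae (Eventually.of_forall c1), intervalIntegral.integral_add
      (intervalIntegrable_linear_mul_logChord _ _ _ _) (d1.intervalIntegrable _ _),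
      integral_linear_mul_logChord 1 0 le_rfl (by norm_num) (by norm_num),
      intervalIntegral.integral_const_mul, intervalIntegral.integral_sub
      (Continuous.intervalIntegrable (by fun_prop) _ _) (hGi _ _), v1]
    simp [hG]
  have w2 : ∫ x in (1 / 3 : ℝ)..(1 / 2), ∫ y in (0 : ℝ)..1, logSide x y =
      (4 * (1 / 2) + (-1)) * G (1 / 2) - (4 * (1 / 3) + (-1)) * G (1 / 3)
        - 4 * (∫ x in (1 / 3 : ℝ)..(1 / 2), G x) +
        2 * ((∫ x in (1 / 2 : ℝ)..(2 / 3), G x) - ∫ x in (1 / 3 : ℝ)..(1 / 2), G x) := by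
    rw [intervalIntegral.integral_congr_ae (Eventually.of_forall c2), intervalIntegral.integral_add
      (intervalIntegrable_linear_mul_logChord _ _ _ _) (d2.intervalIntegrable _ _),
      integral_linear_mul_logChord 4 (-1) (by norm_num) (by norm_num) (by norm_num),
      intervalIntegral.integral_const_mul, intervalIntegral.integral_sub
      (Continuous.intervalIntegrable (by fun_prop) _ _) (hGi _ _), v2]
  rw [← intervalIntegral.integral_add_adjacent_intervals i1 i2, w1, w2, hGsub (1 / 2) (2 / 3),
    hGsub (1 / 3) (1 / 2), integral_integral_logChord_half, integral_integral_logChord_third,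
    integral_integral_logChord_two_thirds, show G (1 / 2) = 0 from integral_logChord_half]
  field_simp
  ring

theorem etaConst_eq : etaConst = 4 * (riemannZeta 3).re / Real.pi ^ 2 := by
  have h : (riemannZeta 2).re = Real.pi ^ 2 / 6 := by
    rw [riemannZeta_two, ← Complex.ofReal_pow, ← Complex.ofReal_ofNat, ← Complex.ofReal_div,
      Complex.ofReal_re]
  rw [etaConst, h]
  field_simp
  ring

theorem integral_integral_logSide :
    ∫ x in (0 : ℝ)..1, ∫ y in (0 : ℝ)..1, logSide x y = etaConst := by
  obtain ⟨hi, hv⟩ := integral_logSide_half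
  set J : ℝ → ℝ := fun x => ∫ y in (0 : ℝ)..1, logSide x y with hJ
  have hsymm : ∀ x, J (1 - x) = J x := by
    intro x
    have h := intervalIntegral.integral_comp_sub_left (a := 0) (b := 1) (logSide (1 - x)) 1
    rw [sub_self, sub_zero] at h
    simp only [hJ]
    rw [← h]
    refine intervalIntegral.integral_congr fun y _ => ?_
    simp only [logSide, longestSide_one_sub]
  have hv2 : ∫ x in (1 / 2 : ℝ)..1, J x = ∫ x in (0 : ℝ)..(1 / 2), J x := by
    have h := intervalIntegral.integral_comp_sub_left (a := 0) (b := 1 / 2) J 1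
    simp only [hsymm] at h
    rw [h]
    norm_num
  have hi2 : IntervalIntegrable J MeasureTheory.volume (1 / 2) 1 := by
    have h := (hi.comp_sub_left 1).symm
    simp only [hsymm] at h
    norm_num at h
    exact h
  rw [← intervalIntegral.integral_add_adjacent_intervals hi hi2, hv2, hv, etaConst_eq]
  ring

/-! ### Truncation of the logarithmic singularity -/

section TorusIntegrals
open MeasureTheory

instance : IsProbabilityMeasure (volume : Measure UnitAddCircle) := ⟨UnitAddCircle.measure_univ⟩

theorem measurable_log_chord : Measurable fun t : UnitAddCircle => Real.log (chord t) :=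
  Real.measurable_log.comp continuous_chord.measurable

theorem integrable_log_chord : Integrable fun t : UnitAddCircle => Real.log (chord t) := by
  have h := intervalIntegrable_logChord 0 (0 + 1)
  rw [intervalIntegrable_iff_integrableOn_Ioc_of_le (by norm_num)] at h
  exact ((UnitAddCircle.measurePreserving_mk 0).integrable_comp
    measurable_log_chord.aestronglyMeasurable).1 h

theorem integral_log_chord : ∫ t : UnitAddCircle, Real.log (chord t) = 0 := by
  rw [← UnitAddCircle.intervalIntegral_preimage 0, zero_add]
  exact integral_logChord_one

theorem integral_eval (g : UnitAddCircle → ℝ) (hg : Measurable g) (i : Fin 2) :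
    ∫ z : UnitAddTorus (Fin 2), g (z i) = ∫ t, g t := by
  have h := measurePreserving_eval (fun _ : Fin 2 => (volume : Measure UnitAddCircle)) i
  have h2 := integral_map (μ := Measure.pi fun _ : Fin 2 => (volume : Measure UnitAddCircle))
    h.measurable.aemeasurable (f := g) (by rw [h.map_eq]; exact hg.aestronglyMeasurable)
  rw [h.map_eq] at h2
  exact h2.symm

theorem integrable_eval {g : UnitAddCircle → ℝ} (hg : Integrable g) (i : Fin 2) :
    Integrable fun z : UnitAddTorus (Fin 2) => g (z i) :=
  (measurePreserving_eval (fun _ : Fin 2 => (volume : Measure UnitAddCircle))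
    i).integrable_comp_of_integrable hg

theorem longestSide_le_two (z : UnitAddTorus (Fin 2)) : longestSide z ≤ 2 :=
  max_le (max_le (chord_le_two _) (chord_le_two _)) (chord_le_two _)

theorem longestSide_zero : longestSide 0 = 0 := by
  have : chord 0 = 0 := chord_eq_zero.2 rfl
  simp [longestSide, this]

theorem longestSide_pos {z : UnitAddTorus (Fin 2)} (hz : z ≠ 0) : 0 < longestSide z := by
  obtain ⟨i, hi⟩ := Function.ne_iff.1 hz
  exact (chord_pos hi).trans_le (chord_le_longestSide z i)

/-- The amount by which truncation from below at `log δ` raises `log chord`. -/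
noncomputable def logGap (δ : ℝ) (t : UnitAddCircle) : ℝ := max (Real.log δ - Real.log (chord t)) 0

theorem logGap_nonneg (δ : ℝ) (t : UnitAddCircle) : 0 ≤ logGap δ t := le_max_right _ _

theorem logGap_le {δ : ℝ} (h0 : 0 ≤ δ) (h1 : δ ≤ 1) (t : UnitAddCircle) :
    logGap δ t ≤ |Real.log (chord t)| := by
  refine max_le ?_ (abs_nonneg _)
  have := Real.log_nonpos h0 h1
  linarith [neg_abs_le (Real.log (chord t))]

theorem log_max_eq {a δ : ℝ} (ha : 0 < a) (hδ : 0 < δ) :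
    Real.log (max a δ) = Real.log a + max (Real.log δ - Real.log a) 0 := by
  rcases le_total a δ with h | h
  · have := Real.log_le_log ha h
    rw [max_eq_right h, max_eq_left (by linarith)]; ring
  · have := Real.log_le_log hδ h
    rw [max_eq_left h, max_eq_right (by linarith)]; ring

theorem integrable_logGap {δ : ℝ} (h0 : 0 ≤ δ) (h1 : δ ≤ 1) : Integrable (logGap δ) := by
  refine integrable_log_chord.abs.mono'
    ((measurable_const.sub measurable_log_chord).max measurable_const).aestronglyMeasurable
    (Eventually.of_forall fun t => ?_)
  rw [Real.norm_of_nonneg (logGap_nonneg δ t)]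
  exact logGap_le h0 h1 t

theorem measurable_logGap (δ : ℝ) : Measurable (logGap δ) :=
  (measurable_const.sub measurable_log_chord).max measurable_const

theorem tendsto_integral_logGap : Tendsto (fun δ : ℝ => ∫ t, logGap δ t) (𝓝[>] 0) (𝓝 0) := by
  have hev : ∀ᶠ δ : ℝ in 𝓝[>] 0, 0 < δ ∧ δ ≤ 1 := by
    filter_upwards [Ioc_mem_nhdsGT (show (0 : ℝ) < 1 from one_pos)] with δ hδ using hδ
  have h := tendsto_integral_filter_of_dominated_convergence
    (μ := (volume : Measure UnitAddCircle)) (l := 𝓝[>] (0 : ℝ)) (F := logGap) (f := fun _ => 0)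
    (fun t => |Real.log (chord t)|)
    (Eventually.of_forall fun δ => (measurable_logGap δ).aestronglyMeasurable)
    (by
      filter_upwards [hev] with δ hδ
      refine Eventually.of_forall fun t => ?_
      rw [Real.norm_of_nonneg (logGap_nonneg δ t)]
      exact logGap_le hδ.1.le hδ.2 t)
    integrable_log_chord.abs
    (Eventually.of_forall fun t => by
      refine tendsto_const_nhds.congr' ?_
      filter_upwards [Ioo_mem_nhdsGT (Real.exp_pos (Real.log (chord t)))] with δ hδ
      have := Real.log_lt_log hδ.1 hδ.2
      rw [Real.log_exp] at this
      exact (max_eq_right (by linarith)).symm)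
  simpa using h

theorem ae_ne_zero : ∀ᵐ t : UnitAddCircle, t ≠ 0 := by
  have h := (UnitAddCircle.measurePreserving_mk 0).map_eq
  rw [← h]
  refine (ae_map_iff (UnitAddCircle.measurePreserving_mk 0).aemeasurable
    (measurableSet_singleton (0 : UnitAddCircle)).compl).2 ?_
  refine ae_restrict_of_ae ?_
  filter_upwards [ae_chord_ne_zero] with x hx h0
  exact hx (chord_eq_zero.2 h0)

theorem integral_log_max_chord {δ : ℝ} (h0 : 0 < δ) (h1 : δ ≤ 1) :
    ∫ t : UnitAddCircle, Real.log (max (chord t) δ) = ∫ t, logGap δ t := by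
  rw [integral_congr_ae (g := fun t => Real.log (chord t) + logGap δ t),
    integral_add integrable_log_chord (integrable_logGap h0.le h1), integral_log_chord, zero_add]
  filter_upwards [ae_ne_zero] with t ht
  exact log_max_eq (chord_pos ht) h0

theorem abs_log_longestSide_le (z : UnitAddTorus (Fin 2)) :
    |Real.log (longestSide z)| ≤
      Real.log 2 + (|Real.log (chord (z 0))| + |Real.log (chord (z 1))|) := by
  have h2 : 0 ≤ Real.log 2 := Real.log_nonneg one_le_two
  rcases eq_or_ne z 0 with rfl | hz
  · rw [longestSide_zero, Real.log_zero, abs_zero]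
    positivity
  have hpos := longestSide_pos hz
  have hup := Real.log_le_log hpos (longestSide_le_two z)
  obtain ⟨i, hi⟩ := Function.ne_iff.1 hz
  have hlow := Real.log_le_log (chord_pos hi) (chord_le_longestSide z i)
  have hi2 : |Real.log (chord (z i))| ≤ |Real.log (chord (z 0))| + |Real.log (chord (z 1))| := by
    fin_cases i
    · exact le_add_of_nonneg_right (abs_nonneg _)
    · exact le_add_of_nonneg_left (abs_nonneg _)
  have hi3 := neg_abs_le (Real.log (chord (z i)))
  rw [abs_le]
  constructor <;> linarith [abs_nonneg (Real.log (chord (z i)))]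

theorem integrable_log_longestSide :
    Integrable fun z : UnitAddTorus (Fin 2) => Real.log (longestSide z) := by
  refine Integrable.mono' ((integrable_const (Real.log 2)).add
    ((integrable_eval integrable_log_chord.abs 0).add (integrable_eval integrable_log_chord.abs 1)))
    (Real.measurable_log.comp continuous_longestSide.measurable).aestronglyMeasurable
    (Eventually.of_forall abs_log_longestSide_le)

theorem integral_log_longestSide :
    ∫ z : UnitAddTorus (Fin 2), Real.log (longestSide z) = etaConst := by
  have hmp := (volume_preserving_finTwoArrow UnitAddCircle).symm
  have h1 := hmp.integral_comp' (fun z : UnitAddTorus (Fin 2) => Real.log (longestSide z))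
  have h2 : Integrable (fun p : UnitAddCircle × UnitAddCircle =>
      Real.log (longestSide ![p.1, p.2])) (volume.prod volume) :=
    hmp.integrable_comp_of_integrable integrable_log_longestSide
  have h3 : ∫ p : UnitAddCircle × UnitAddCircle, Real.log (longestSide ![p.1, p.2]) =
      ∫ z : UnitAddTorus (Fin 2), Real.log (longestSide z) := h1
  rw [← h3, Measure.volume_eq_prod, integral_prod _ h2, ← integral_integral_logSide,
    ← UnitAddCircle.intervalIntegral_preimage 0, zero_add]
  refine intervalIntegral.integral_congr fun x _ => ?_
  simp only
  rw [← UnitAddCircle.intervalIntegral_preimage 0, zero_add]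
  rfl

theorem log_max_longestSide_sub {δ : ℝ} (h0 : 0 < δ) {z : UnitAddTorus (Fin 2)} (hz : z ≠ 0) :
    |Real.log (longestSide z) - Real.log (max (longestSide z) δ)| ≤
      logGap δ (z 0) + logGap δ (z 1) := by
  rw [log_max_eq (longestSide_pos hz) h0, sub_add_cancel_left, abs_neg,
    abs_of_nonneg (le_max_right _ _)]
  obtain ⟨i, hi⟩ := Function.ne_iff.1 hz
  have hi2 : logGap δ (z i) ≤ logGap δ (z 0) + logGap δ (z 1) := by
    fin_cases i
    · exact le_add_of_nonneg_right (logGap_nonneg _ _)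
    · exact le_add_of_nonneg_left (logGap_nonneg _ _)
  refine le_trans (max_le_max ?_ le_rfl) hi2
  exact sub_le_sub_left (Real.log_le_log (chord_pos hi) (chord_le_longestSide z i)) _

/-- The continuous function obtained from `log longestSide` by truncation from below at `log δ`. -/
noncomputable def logTruncSide (δ : ℝ) (h0 : 0 < δ) : C(UnitAddTorus (Fin 2), ℝ) where
  toFun z := Real.log (max (longestSide z) δ)
  continuous_toFun := (continuous_longestSide.max continuous_const).log
    fun _ => (lt_max_of_lt_right h0).ne'

/-- The truncation of `log chord`, as a function of the first coordinate of the torus, so that the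
two-dimensional equidistribution theorem applies to it. -/
noncomputable def logTruncChord (δ : ℝ) (h0 : 0 < δ) : C(UnitAddTorus (Fin 2), ℝ) where
  toFun z := Real.log (max (chord (z 0)) δ)
  continuous_toFun := ((continuous_chord.comp (continuous_apply 0)).max continuous_const).log
    fun _ => (lt_max_of_lt_right h0).ne'

theorem abs_integral_logTruncSide_sub_le {δ : ℝ} (h0 : 0 < δ) (h1 : δ ≤ 1) :
    |(∫ z, logTruncSide δ h0 z) - etaConst| ≤ 2 * ∫ t, logGap δ t := by
  have hg := integrable_logGap h0.le h1
  have hz : ∀ᵐ z : UnitAddTorus (Fin 2), z ≠ 0 := by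
    have := (measurePreserving_eval (fun _ : Fin 2 => (volume : Measure UnitAddCircle))
      0).quasiMeasurePreserving.ae ae_ne_zero
    filter_upwards [this] with z hz h
    exact hz (by rw [h]; rfl)
  have hint := (integrable_eval hg 0).add (integrable_eval hg 1)
  have e2 : ∫ z : UnitAddTorus (Fin 2), (logGap δ (z 0) + logGap δ (z 1)) =
      2 * ∫ t, logGap δ t := by
    rw [integral_add (integrable_eval hg 0) (integrable_eval hg 1),
      integral_eval _ (measurable_logGap δ), integral_eval _ (measurable_logGap δ)]
    ring
  rw [← e2, ← integral_log_longestSide, ← integral_sub (integrable_continuousMap_torus _)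
    integrable_log_longestSide]
  refine (abs_integral_le_integral_abs).trans (integral_mono_ae
    ((integrable_continuousMap_torus _).sub integrable_log_longestSide).abs hint ?_)
  filter_upwards [hz] with z hz
  rw [abs_sub_comm]
  exact log_max_longestSide_sub h0 hz

end TorusIntegrals

section Sums
variable {d : ℕ} [NeZero d]

theorem sum_apply_eq (F : ZMod d → ℝ) (i : Fin 2) :
    ∑ v : Fin 2 → ZMod d, F (v i) = d * ∑ t, F t := by
  rw [Fintype.sum_equiv (finTwoArrowEquiv (ZMod d)) (fun v => F (v i))
    (fun p => F (![p.1, p.2] i)) (fun v => by fin_cases i <;> rfl), Fintype.sum_prod_type]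
  fin_cases i
  · simp [ZMod.card, Finset.mul_sum]
  · simp [ZMod.card]

/-- The logarithm of `∏ (1 - ζ ^ k) = d`, the product over `0 < k < d`; the term at `0` is
`log 0 = 0`. -/
theorem sum_log_chord : ∑ t : ZMod d, Real.log (chord (ZMod.toAddCircle t)) = Real.log d := by
  obtain ⟨n, rfl⟩ := Nat.exists_eq_succ_of_ne_zero (NeZero.ne d)
  have h := (isPrimitiveRoot_stdAddChar_one (d := n + 1)).prod_one_sub_pow_eq_order
  have h2 : ∏ k ∈ Finset.range n, chord (ZMod.toAddCircle ((k + 1 : ℕ) : ZMod (n + 1))) =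
      ((n + 1 : ℕ) : ℝ) := by
    have h3 := congrArg norm h
    rw [norm_prod] at h3
    rw [Finset.prod_congr rfl fun k _ => (show
      chord (ZMod.toAddCircle ((k + 1 : ℕ) : ZMod (n + 1))) =
      ‖1 - (ZMod.stdAddChar (1 : ZMod (n + 1)) : ℂ) ^ (k + 1)‖ by
        rw [chord_toAddCircle, ← stdAddChar_natCast_mul, mul_one, norm_sub_rev]), h3]
    rw [← Nat.cast_succ, Complex.norm_natCast]
  have h4 : ∑ t : ZMod (n + 1), Real.log (chord (ZMod.toAddCircle t)) =
      ∑ k ∈ Finset.range (n + 1), Real.log (chord (ZMod.toAddCircle ((k : ℕ) : ZMod (n + 1)))) := by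
    refine Finset.sum_bij' (fun t _ => t.val) (fun k _ => (k : ZMod (n + 1))) ?_ ?_ ?_ ?_ ?_
    · intro t _; exact Finset.mem_range.2 (ZMod.val_lt t)
    · intro k _; exact Finset.mem_univ _
    · intro t _; exact ZMod.natCast_zmod_val t
    · intro k hk; exact ZMod.val_cast_of_lt (Finset.mem_range.1 hk)
    · intro t _; rw [ZMod.natCast_zmod_val]
  have h0 : chord (0 : UnitAddCircle) = 0 := chord_eq_zero.2 rfl
  rw [h4, Finset.sum_range_succ', Nat.cast_zero, map_zero, h0, Real.log_zero, add_zero,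
    ← Real.log_prod, h2]
  intro k hk h5
  have h6 : (∏ k ∈ Finset.range n, chord (ZMod.toAddCircle ((k + 1 : ℕ) : ZMod (n + 1)))) = 0 :=
    Finset.prod_eq_zero hk h5
  rw [h2] at h6
  exact (Nat.cast_ne_zero.2 n.succ_ne_zero) h6

/-- At `t = 0`, where `log 0 = 0`, the gap vanishes because `δ ≤ 1`, but the truncated logarithm is
`log δ`; this accounts for the term `-log δ` on the right. -/
theorem sum_logGap {δ : ℝ} (h0 : 0 < δ) (h1 : δ ≤ 1) :
    ∑ t : ZMod d, logGap δ (ZMod.toAddCircle t) =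
      ∑ t : ZMod d, Real.log (max (chord (ZMod.toAddCircle t)) δ) - Real.log δ - Real.log d := by
  rw [← sum_log_chord (d := d), sub_right_comm, ← Finset.sum_sub_distrib, eq_sub_iff_add_eq,
    ← Finset.sum_erase_add _ _ (Finset.mem_univ (0 : ZMod d)),
    ← Finset.sum_erase_add _ _ (Finset.mem_univ (0 : ZMod d)), add_assoc]
  congr 1
  · refine Finset.sum_congr rfl fun t ht => ?_
    have ht' : ZMod.toAddCircle t ≠ 0 := by
      rw [Ne, ZMod.toAddCircle_eq_zero]; exact Finset.ne_of_mem_erase ht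
    rw [log_max_eq (chord_pos ht') h0, add_sub_cancel_left]
    rfl
  · have h : chord (0 : UnitAddCircle) = 0 := chord_eq_zero.2 rfl
    have := Real.log_nonpos h0.le h1
    rw [map_zero, logGap, h, Real.log_zero, sub_zero, sub_zero, max_eq_right h0.le,
      max_eq_right this, zero_add]

theorem torsionPoint_ne_zero {v : Fin 2 → ZMod d} (hv : v ≠ 0) : torsionPoint v ≠ 0 := by
  obtain ⟨i, hi⟩ := Function.ne_iff.1 hv
  refine Function.ne_iff.2 ⟨i, ?_⟩
  rw [torsionPoint, Pi.zero_apply, Ne, ZMod.toAddCircle_eq_zero]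
  exact hi

theorem smul_mem_erase_zero (s : (ZMod d)ˣ) :
    ∀ v ∈ Finset.univ.erase (0 : Fin 2 → ZMod d),
      s • v ∈ Finset.univ.erase (0 : Fin 2 → ZMod d) := by
  intro v hv
  simp only [Finset.mem_erase, Finset.mem_univ, and_true] at hv ⊢
  rwa [Ne, smul_eq_zero_iff_eq]

theorem torsionMean_eq_orbitMean (F : (Fin 2 → ZMod d) → ℝ) :
    torsionMean d (fun v => orbitMean d F v) = torsionMean d F := by
  rw [torsionMean, sum_orbitMean Finset.univ (fun _ _ _ => Finset.mem_univ _), torsionMean]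

end Sums

/-- The Riemann sums of the unbounded function `logGap δ` are asymptotically at most its integral:
by the product formula `log chord` has nonnegative sums, and its integral vanishes. -/
theorem eventually_sum_logGap_le {δ ε : ℝ} (h0 : 0 < δ) (h1 : δ ≤ 1) (hε : 0 < ε) :
    ∀ᶠ d : ℕ in atTop, ∀ [NeZero d],
      ∑ t : ZMod d, logGap δ (ZMod.toAddCircle t) ≤ d * ((∫ t, logGap δ t) + ε) := by
  have hlim : Tendsto (fun d : ℕ => -Real.log δ / d) atTop (𝓝 0) :=
    tendsto_const_nhds.div_atTop tendsto_natCast_atTop_atTop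
  filter_upwards [eventually_torsionMean_orbitMean_le (logTruncChord δ h0) (half_pos hε),
    hlim.eventually (gt_mem_nhds (half_pos hε))] with d h2 h3 _
  have hd : (0 : ℝ) < d := Nat.cast_pos.2 (Nat.pos_of_ne_zero (NeZero.ne d))
  have hI : ∫ z, logTruncChord δ h0 z = ∫ t, logGap δ t := by
    rw [← integral_log_max_chord h0 h1]
    exact integral_eval (fun t => Real.log (max (chord t) δ))
      (Real.measurable_log.comp (continuous_chord.measurable.max measurable_const)) 0
  have h4 : torsionMean d (fun v => logTruncChord δ h0 (torsionPoint v)) -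
      ∫ t, logGap δ t ≤ ε / 2 := by
    refine le_trans (le_of_eq ?_) ((torsionMean_mono fun v => le_abs_self _).trans (@h2 _))
    rw [← torsionMean_eq_orbitMean, ← hI]
    simp_rw [sub_eq_add_neg]
    rw [torsionMean_add, torsionMean_const]
  have h5 : torsionMean d (fun v => logTruncChord δ h0 (torsionPoint v)) =
      (∑ t : ZMod d, Real.log (max (chord (ZMod.toAddCircle t)) δ)) / d := by
    have := sum_apply_eq (fun t : ZMod d => Real.log (max (chord (ZMod.toAddCircle t)) δ)) 0
    rw [torsionMean]
    change ((d : ℝ) ^ 2)⁻¹ * ∑ v : Fin 2 → ZMod d,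
      Real.log (max (chord (ZMod.toAddCircle (v 0))) δ) = _
    rw [this]
    field_simp
  rw [sum_logGap h0 h1]
  rw [h5, sub_le_iff_le_add, div_le_iff₀ hd] at h4
  rw [div_lt_iff₀ hd] at h3
  have h6 : 0 ≤ Real.log d := Real.log_natCast_nonneg d
  linarith

/-- A bound for the contribution of the finite places that does not depend on which coordinate of
`v` is nonzero. -/
theorem abs_interHeight_sub_le {d : ℕ} [NeZero d] {ζ : QBar} (hζ : IsPrimitiveRoot ζ d)
    (ω : (Fin 2 → ZMod d) → Torus 2) (hω : ∀ v i, (ω v i : QBar)⁻¹ = ζ ^ (v i).val)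
    {v : Fin 2 → ZMod d} (hv : v ≠ 0) :
    |interHeight (ω v) - orbitMean d (fun w => Real.log (longestSide (torsionPoint w))) v| ≤
      orbitMean d (fun t : ZMod d => Real.log (chord (ZMod.toAddCircle t))) (v 0) +
      orbitMean d (fun t : ZMod d => Real.log (chord (ZMod.toAddCircle t))) (v 1) := by
  have hnn : ∀ t : ZMod d,
      0 ≤ orbitMean d (fun t : ZMod d => Real.log (chord (ZMod.toAddCircle t))) t := by
    intro t
    rcases eq_or_ne t 0 with rfl | ht
    · have h : chord (0 : UnitAddCircle) = 0 := chord_eq_zero.2 rfl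
      simp [orbitMean, h]
    -- For `t ≠ 0` the orbit mean bounds a distance, by `interHeight_bounds` at `(t, t)`.
    · exact (abs_nonneg _).trans (interHeight_bounds hζ (fun _ => t) (ω fun _ => t)
        (hω _) 0 ht)
  obtain ⟨i, hi⟩ := Function.ne_iff.1 hv
  refine (interHeight_bounds hζ v (ω v) (hω v) i hi).trans ?_
  fin_cases i
  · exact le_add_of_nonneg_right (hnn _)
  · exact le_add_of_nonneg_left (hnn _)

/-- The distance from the height to `η` is split into four parts: the finite places, the truncation
of the singularity, the equidistribution of the truncated function, and the change of its integral
by truncation. -/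
theorem eventually_sum_abs_interHeight_sub_le {ε : ℝ} (hε : 0 < ε) :
    ∀ᶠ d : ℕ in atTop, ∀ [NeZero d], ∀ ζ : QBar, IsPrimitiveRoot ζ d →
      ∀ ω : (Fin 2 → ZMod d) → Torus 2, (∀ v i, (ω v i : QBar)⁻¹ = ζ ^ (v i).val) →
      ∑ v ∈ Finset.univ.erase (0 : Fin 2 → ZMod d), |interHeight (ω v) - etaConst| ≤
        ε * (d : ℝ) ^ 2 := by
  obtain ⟨δ, hδ, h0, h1⟩ : ∃ δ : ℝ, ∫ t, logGap δ t < ε / 8 ∧ 0 < δ ∧ δ ≤ 1 := by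
    have hev : ∀ᶠ δ : ℝ in 𝓝[>] 0, 0 < δ ∧ δ ≤ 1 := by
      filter_upwards [Ioc_mem_nhdsGT (show (0 : ℝ) < 1 from one_pos)] with δ hδ using hδ
    exact ((tendsto_integral_logGap.eventually (gt_mem_nhds (by positivity))).and hev).exists
  have hlim : Tendsto (fun d : ℕ => Real.log d / d) atTop (𝓝 0) := by
    have := (Real.isLittleO_log_id_atTop.tendsto_div_nhds_zero).comp tendsto_natCast_atTop_atTop
    exact this
  filter_upwards [eventually_torsionMean_orbitMean_le (logTruncSide δ h0)
    (show 0 < ε / 16 by positivity), eventually_sum_logGap_le h0 h1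
    (show 0 < ε / 16 by positivity), hlim.eventually (gt_mem_nhds (show 0 < ε / 16 by positivity))]
    with d e1 e2 e3 _ ζ hζ ω hω
  have hd : (0 : ℝ) < d := Nat.cast_pos.2 (Nat.pos_of_ne_zero (NeZero.ne d))
  set S := Finset.univ.erase (0 : Fin 2 → ZMod d) with hS
  set f : (Fin 2 → ZMod d) → ℝ := fun w => Real.log (longestSide (torsionPoint w)) with hf
  set fδ : (Fin 2 → ZMod d) → ℝ := fun w => logTruncSide δ h0 (torsionPoint w) with hfδ
  set c := ∫ z, logTruncSide δ h0 z with hc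
  set ℓ : ZMod d → ℝ := fun t => Real.log (chord (ZMod.toAddCircle t)) with hℓ
  have t1 : ∑ v ∈ S, |interHeight (ω v) - orbitMean d f v| ≤ 2 * d * Real.log d := by
    calc _ ≤ ∑ v ∈ S, (orbitMean d ℓ (v 0) + orbitMean d ℓ (v 1)) :=
          Finset.sum_le_sum fun v hv =>
            abs_interHeight_sub_le hζ ω hω (Finset.ne_of_mem_erase hv)
      _ = ∑ v : Fin 2 → ZMod d, (orbitMean d ℓ (v 0) + orbitMean d ℓ (v 1)) := by
          refine Finset.sum_erase _ ?_
          have h : chord (0 : UnitAddCircle) = 0 := chord_eq_zero.2 rfl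
          simp [orbitMean, hℓ, h]
      _ = _ := by
          rw [Finset.sum_add_distrib, sum_apply_eq, sum_apply_eq,
            sum_orbitMean Finset.univ (fun _ _ _ => Finset.mem_univ _), sum_log_chord]
          ring
  have t2 : ∑ v ∈ S, |orbitMean d f v - orbitMean d fδ v| ≤
      2 * d * ∑ t : ZMod d, logGap δ (ZMod.toAddCircle t) := by
    calc _ ≤ ∑ v ∈ S, orbitMean d (fun w => |f w - fδ w|) v := by
          refine Finset.sum_le_sum fun v _ => ?_
          rw [← orbitMean_sub]
          exact norm_orbitMean_le (fun w => f w - fδ w) v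
      _ = ∑ v ∈ S, |f v - fδ v| := sum_orbitMean S smul_mem_erase_zero _
      _ ≤ ∑ v ∈ S, (logGap δ (ZMod.toAddCircle (v 0)) + logGap δ (ZMod.toAddCircle (v 1))) :=
          Finset.sum_le_sum fun v hv =>
            log_max_longestSide_sub h0 (torsionPoint_ne_zero (Finset.ne_of_mem_erase hv))
      _ ≤ ∑ v : Fin 2 → ZMod d,
          (logGap δ (ZMod.toAddCircle (v 0)) + logGap δ (ZMod.toAddCircle (v 1))) :=
          Finset.sum_le_sum_of_subset_of_nonneg (Finset.subset_univ _)
            fun v _ _ => add_nonneg (logGap_nonneg _ _) (logGap_nonneg _ _)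
      _ = _ := by
          rw [Finset.sum_add_distrib,
            sum_apply_eq (fun t : ZMod d => logGap δ (ZMod.toAddCircle t)),
            sum_apply_eq (fun t : ZMod d => logGap δ (ZMod.toAddCircle t))]
          ring
  have t3 : ∑ v ∈ S, |orbitMean d fδ v - c| ≤ d ^ 2 * (ε / 16) := by
    have h := @e1 _
    rw [torsionMean, inv_mul_le_iff₀ (by positivity)] at h
    exact (Finset.sum_le_sum_of_subset_of_nonneg (Finset.subset_univ _)
            fun v _ _ => abs_nonneg _).trans h
  have t4 : ∑ v ∈ S, |c - etaConst| ≤ d ^ 2 * (2 * ∫ t, logGap δ t) := by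
    rw [Finset.sum_const, nsmul_eq_mul]
    have hcard : (S.card : ℝ) ≤ d ^ 2 := by
      have : S.card ≤ d ^ 2 := by
        refine (Finset.card_le_univ _).trans (le_of_eq ?_)
        rw [Fintype.card_pi_const, ZMod.card]
      exact_mod_cast this
    exact mul_le_mul hcard (abs_integral_logTruncSide_sub_le h0 h1) (abs_nonneg _) (by positivity)
  have t : ∑ v ∈ S, |interHeight (ω v) - etaConst| ≤
      ∑ v ∈ S, |interHeight (ω v) - orbitMean d f v| +
      ∑ v ∈ S, |orbitMean d f v - orbitMean d fδ v| + ∑ v ∈ S, |orbitMean d fδ v - c| +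
      ∑ v ∈ S, |c - etaConst| := by
    rw [← Finset.sum_add_distrib, ← Finset.sum_add_distrib, ← Finset.sum_add_distrib]
    refine Finset.sum_le_sum fun v _ => ?_
    have := abs_sub_le (interHeight (ω v)) (orbitMean d f v) etaConst
    have := abs_sub_le (orbitMean d f v) (orbitMean d fδ v) etaConst
    have := abs_sub_le (orbitMean d fδ v) c etaConst
    linarith
  have g1 : 2 * d * Real.log d ≤ d ^ 2 * (ε / 8) := by
    rw [div_lt_iff₀ hd] at e3
    nlinarith
  have g2 : 2 * d * ∑ t : ZMod d, logGap δ (ZMod.toAddCircle t) ≤ d ^ 2 * (3 * ε / 8) := by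
    have h := @e2 _
    calc _ ≤ 2 * d * (d * ((∫ t, logGap δ t) + ε / 16)) := by gcongr
      _ ≤ 2 * d * (d * (ε / 8 + ε / 16)) := by gcongr
      _ = _ := by ring
  have g4 : (d : ℝ) ^ 2 * (2 * ∫ t, logGap δ t) ≤ d ^ 2 * (ε / 4) := by
    gcongr
    linarith
  nlinarith [sq_nonneg (d : ℝ)]

/-! ### Averages over the torsion points -/

/-- An enumeration of the torsion points by exponent vectors, given a primitive root of unity. -/
theorem exists_torsion_parametrization {d : ℕ} [NeZero d] : ∃ ζ : QBar, IsPrimitiveRoot ζ d ∧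
    ∃ ω : (Fin 2 → ZMod d) → Torus 2, (∀ v i, (ω v i : QBar)⁻¹ = ζ ^ (v i).val) ∧
      Function.Injective ω ∧
      nontrivialTorsion d = ω '' (Finset.univ.erase (0 : Fin 2 → ZMod d) : Finset _) := by
  obtain ⟨ζ, hζ⟩ := HasEnoughRootsOfUnity.exists_primitiveRoot QBar d
  obtain ⟨u, rfl⟩ := hζ.isUnit (NeZero.ne d)
  have hu : IsPrimitiveRoot u d := IsPrimitiveRoot.coe_units_iff.1 hζ
  have hinj : Function.Injective fun v : Fin 2 → ZMod d =>
      (fun i => (u ^ (v i).val)⁻¹ : Torus 2) := by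
    intro v w h
    funext i
    exact ZMod.val_injective d (hu.pow_inj (ZMod.val_lt _) (ZMod.val_lt _)
      (inv_injective (congrFun h i)))
  have h0 : (fun i => (u ^ ((0 : Fin 2 → ZMod d) i).val)⁻¹ : Torus 2) = 1 := by
    funext i
    simp
  refine ⟨u, hζ, fun v i => (u ^ (v i).val)⁻¹, fun v i => by simp, hinj, ?_⟩
  ext ω
  constructor
  · rintro ⟨h1, h2⟩
    have h3 : ∀ i, ∃ k < d, u ^ k = (ω i)⁻¹ := fun i =>
      hu.eq_pow_of_mem_rootsOfUnity (inv_mem (h1 i))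
    choose k hk hkω using h3
    have h4 : (fun i => (u ^ ((k i : ℕ) : ZMod d).val)⁻¹ : Torus 2) = ω := by
      funext i
      rw [ZMod.val_cast_of_lt (hk i), hkω, inv_inv]
    refine ⟨fun i => (k i : ZMod d), ?_, h4⟩
    rw [Finset.mem_coe, Finset.mem_erase]
    refine ⟨fun h => h2 ?_, Finset.mem_univ _⟩
    rw [Set.mem_singleton_iff, ← h4, ← h0, ← h]
  · rintro ⟨v, hv, rfl⟩
    refine ⟨fun i => inv_mem ?_, fun h => ?_⟩
    · rw [mem_rootsOfUnity, ← pow_mul, mul_comm, pow_mul, hu.pow_eq_one, one_pow]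
    · exact Finset.ne_of_mem_erase hv (hinj (h.trans h0.symm))

theorem finsum_nontrivialTorsion_eq {d : ℕ} [NeZero d] {ω : (Fin 2 → ZMod d) → Torus 2}
    (hω : Function.Injective ω)
    (h : nontrivialTorsion d = ω '' (Finset.univ.erase (0 : Fin 2 → ZMod d) : Finset _))
    (F : Torus 2 → ℝ) :
    ∑ᶠ x ∈ nontrivialTorsion d, F x = ∑ v ∈ Finset.univ.erase (0 : Fin 2 → ZMod d), F (ω v) := by
  rw [h, finsum_mem_image hω.injOn, finsum_mem_coe_finset]

theorem finite_nontrivialTorsion {d : ℕ} [NeZero d] : (nontrivialTorsion d).Finite := by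
  obtain ⟨ζ, -, ω, -, -, h⟩ := exists_torsion_parametrization (d := d)
  rw [h]
  exact (Finset.finite_toSet _).image _

theorem ncard_nontrivialTorsion {d : ℕ} [NeZero d] :
    ((nontrivialTorsion d).ncard : ℝ) = (d : ℝ) ^ 2 - 1 := by
  obtain ⟨ζ, -, ω, -, hinj, h⟩ := exists_torsion_parametrization (d := d)
  rw [h, Set.ncard_image_of_injective _ hinj, Set.ncard_coe_finset,
    Finset.card_erase_of_mem (Finset.mem_univ _), Finset.card_univ, Fintype.card_pi_const,
    ZMod.card, Nat.cast_sub (Nat.one_le_pow _ _ (Nat.pos_of_ne_zero (NeZero.ne d)))]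
  push_cast
  rfl

/-- The heights converge to `η` in the mean. -/
theorem tendsto_mean_abs_interHeight_sub : Tendsto (fun d : ℕ => 1 / ((d : ℝ) ^ 2 - 1) *
    ∑ᶠ ω ∈ nontrivialTorsion d, |interHeight ω - etaConst|) atTop (𝓝 0) := by
  rw [Metric.tendsto_atTop']
  intro ε hε
  obtain ⟨N, hN⟩ := eventually_atTop.1
    (eventually_sum_abs_interHeight_sub_le (show 0 < ε / 4 by positivity))
  refine ⟨max N 1, fun d hd => ?_⟩
  have hd1 : 2 ≤ d := (le_max_right N 1).trans_lt hd
  have : NeZero d := ⟨by omega⟩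
  obtain ⟨ζ, hζ, ω, hω, hinj, h⟩ := exists_torsion_parametrization (d := d)
  have h1 := hN d ((le_max_left _ _).trans hd.le) ζ hζ ω hω
  rw [← finsum_nontrivialTorsion_eq hinj h fun x => |interHeight x - etaConst|] at h1
  have hd2 : (2 : ℝ) ≤ d := by exact_mod_cast hd1
  have hd3 : 0 < (d : ℝ) ^ 2 - 1 := by nlinarith
  have hnn : 0 ≤ ∑ᶠ x ∈ nontrivialTorsion d, |interHeight x - etaConst| :=
    finsum_nonneg fun _ => finsum_nonneg fun _ => abs_nonneg _
  rw [dist_zero_right, Real.norm_of_nonneg (by positivity), one_div, inv_mul_lt_iff₀ hd3]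
  nlinarith [mul_pos hε (show 0 < (d : ℝ) ^ 2 * 3 / 4 - 1 by nlinarith)]

theorem corollary5p6 :
    (∀ ε : ℝ, 0 < ε →
      Tendsto
        (fun d : ℕ => 1 / ((d : ℝ) ^ 2 - 1) *
          (Set.ncard {ω ∈ nontrivialTorsion d | |interHeight ω - etaConst| < ε} : ℝ))
        atTop (𝓝 1)) ∧
    Tendsto
      (fun d : ℕ => 1 / ((d : ℝ) ^ 2 - 1) * ∑ᶠ ω ∈ nontrivialTorsion d, interHeight ω)
      atTop (𝓝 etaConst) := by
  have key : ∀ᶠ d : ℕ in atTop, 0 < (d : ℝ) ^ 2 - 1 ∧ NeZero d := by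
    filter_upwards [eventually_ge_atTop 2] with d hd
    have hd2 : (2 : ℝ) ≤ d := by exact_mod_cast hd
    exact ⟨by nlinarith, ⟨by omega⟩⟩
  refine ⟨fun ε hε => ?_, ?_⟩
  · rw [tendsto_iff_norm_sub_tendsto_zero]
    refine squeeze_zero' (Eventually.of_forall fun _ => norm_nonneg _) ?_
      (by simpa only [mul_zero] using tendsto_mean_abs_interHeight_sub.const_mul ε⁻¹)
    filter_upwards [key] with d ⟨hd, _⟩
    have hfin := finite_nontrivialTorsion (d := d)
    set A := {ω ∈ nontrivialTorsion d | |interHeight ω - etaConst| < ε} with hA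
    set B := nontrivialTorsion d \ A with hB
    have hAB : (A.ncard : ℝ) + B.ncard = (d : ℝ) ^ 2 - 1 := by
      rw [← ncard_nontrivialTorsion, add_comm, hB]
      exact_mod_cast Set.ncard_sdiff_add_ncard_of_subset (Set.sep_subset _ _) hfin
    have hmarkov : ε * B.ncard ≤ ∑ᶠ ω ∈ nontrivialTorsion d, |interHeight ω - etaConst| := by
      have hBfin : B.Finite := hfin.subset Set.sdiff_subset
      rw [finsum_mem_eq_finite_toFinset_sum (fun ω => |interHeight ω - etaConst|) hfin,
        Set.ncard_eq_toFinset_card B hBfin, mul_comm, ← nsmul_eq_mul]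
      refine (Finset.card_nsmul_le_sum _ _ ε ?_).trans
        (Finset.sum_le_sum_of_subset_of_nonneg
          (Set.Finite.toFinset_subset_toFinset.2 Set.sdiff_subset)
          fun ω _ _ => abs_nonneg (interHeight ω - etaConst))
      intro ω hω
      rw [Set.Finite.mem_toFinset] at hω
      exact not_lt.1 fun h => hω.2 ⟨hω.1, h⟩
    have e : 1 / ((d : ℝ) ^ 2 - 1) * A.ncard - 1 = -(1 / ((d : ℝ) ^ 2 - 1) * B.ncard) := by
      field_simp
      linarith
    rw [e, norm_neg, Real.norm_of_nonneg (by positivity), mul_left_comm]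
    refine mul_le_mul_of_nonneg_left ?_ (one_div_pos.2 hd).le
    rwa [le_inv_mul_iff₀ hε]
  · rw [tendsto_iff_norm_sub_tendsto_zero]
    refine squeeze_zero' (Eventually.of_forall fun _ => norm_nonneg _) ?_
      tendsto_mean_abs_interHeight_sub
    filter_upwards [key] with d ⟨hd, _⟩
    obtain ⟨ζ, -, ω, -, hinj, h⟩ := exists_torsion_parametrization (d := d)
    have hc := ncard_nontrivialTorsion (d := d)
    rw [h, Set.ncard_image_of_injective _ hinj, Set.ncard_coe_finset] at hc
    rw [finsum_nontrivialTorsion_eq hinj h, finsum_nontrivialTorsion_eq hinj h]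
    have e : 1 / ((d : ℝ) ^ 2 - 1) * ∑ v ∈ Finset.univ.erase (0 : Fin 2 → ZMod d),
        interHeight (ω v) - etaConst = 1 / ((d : ℝ) ^ 2 - 1) *
        ∑ v ∈ Finset.univ.erase (0 : Fin 2 → ZMod d), (interHeight (ω v) - etaConst) := by
      rw [Finset.sum_sub_distrib, Finset.sum_const, nsmul_eq_mul, hc]
      field_simp
    rw [e, norm_mul, Real.norm_of_nonneg (by positivity : 0 ≤ 1 / ((d : ℝ) ^ 2 - 1))]
    exact mul_le_mul_of_nonneg_left (Finset.abs_sum_le_sum_abs _ _) (by positivity)
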